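/- Let $Y$ be a smooth toric Calabi-Yau 3-fold given by a finite fan in $\mathbb{Z}^3$ whose maximal cones are 3-dimensional and smooth and whose ray generators all lie in the plane of height one; equivalently, by a finite non-empty collection of lattice triangles of determinant $\pm 1$ in $\mathbb{R}^2$, any two of which meet in a common (possibly empty) face. The vertices $v\in V(\Gamma)$ of the toric graph $\Gamma$ of $Y$ are these triangles (the torus fixed points of $Y$). The weight vectors $w_1^v,w_2^v,w_3^v\in\mathbb{Z}^2$ at $v$ are the linear parts of the three affine functions on the plane that are $1$ at one corner of the triangle and $0$ at the other two; they are the weights, on the cotangent space at the fixed point, of the 2-torus that preserves the holomorphic volume form, and $w_1^v+w_2^v+w_3^v=0$. Identify $w=(a,b)$ with $a t_1+b t_2$. For $\operatorname{Im}\tau>0$ let $$\theta_1(\tau,z)=i\sum_{n\in\mathbb{Z}}(-1)^n q^{(n-1/2)^2/2}y^{n-1/2},\qquad q=e^{2\pi i\tau},\ y=e^{2\pi i z},$$ and define the equivariant elliptic genus of $Y$ by $$Z_Y(\tau,z;t_1,t_2)=\sum_{v\in V(\Gamma)}\prod_{j=1}^{3}\frac{\theta_1(\tau,z+w_j^v)}{\theta_1(\tau,w_j^v)}$$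 for all $(t_1,t_2)$ at which no denominator vanishes. Call $Y$ balanced if one can assign to every vertex $v$ of $\Gamma$ another vertex $v'$ (its balancing vertex) such that, for suitable orderings of the weights, $w_j^v+w_j^{v'}=0$ for $j=1,2,3$, and such that different vertices have different balancing vertices. Let $Y$ be balanced. Then $Z_Y(\tau,z;t_1,t_2)$ is independent of $t_1$ and $t_2$, and, whenever $\theta_1(\tau,z)\neq 0$, $$Z_Y(\tau,z;t_1,t_2)=\frac{\chi(Y)}{2}\,\frac{\theta_1(\tau,2z)}{\theta_1(\tau,z)},$$ where $\chi(Y)=\sum_k(-1)^k\dim H_k(Y;\mathbb{Q})$ is the topological Euler characteristic of $Y$ (its rational homology being finite-dimensional). -/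

import Mathlib

noncomputable section

/-- Jacobi's theta function
`θ₁(τ, z) = i ∑_{n ∈ ℤ} (-1)^n q^{(n-1/2)²/2} y^{n-1/2}`, where `q^a = exp (2πi τ a)` and
`y^a = exp (2πi z a)`. -/
def theta1 (τ z : ℂ) : ℂ :=
  Complex.I * ∑' n : ℤ, (-1 : ℂ) ^ n *
    Complex.exp (2 * (Real.pi : ℂ) * Complex.I * τ * (((n : ℂ) - 1 / 2) ^ 2 / 2)) *
    Complex.exp (2 * (Real.pi : ℂ) * Complex.I * z * ((n : ℂ) - 1 / 2))

/-- A lattice point of the plane, regarded as a point of `ℝ²`. -/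
def latticePoint (p : ℤ × ℤ) : ℝ × ℝ := ((p.1 : ℝ), (p.2 : ℝ))

/-- The determinant `det (b - a, c - a)`. -/
def latticeDet (a b c : ℤ × ℤ) : ℤ :=
  (b.1 - a.1) * (c.2 - a.2) - (b.2 - a.2) * (c.1 - a.1)

/-- The combinatorial data of a (smooth) toric Calabi-Yau 3-fold: a finite smooth fan in `ℤ³`
whose maximal cones are 3-dimensional and whose ray generators all lie on the affine plane of
height one (this is the Calabi-Yau condition). Cutting the fan with that plane, the maximal cones
become finitely many lattice triangles of determinant `±1`, any two of which meet in a common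
face (possibly empty). The cone over the triangle `v` is spanned by the vectors
`(corner v j, 1)`, `j = 0, 1, 2`. -/
structure ToricCY3 where
  /-- the number of maximal cones -/
  numVertices : ℕ
  numVertices_pos : 0 < numVertices
  /-- the three corners of a triangle -/
  corner : Fin numVertices → Fin 3 → ℤ × ℤ
  unimodular : ∀ v, latticeDet (corner v 0) (corner v 1) (corner v 2) = 1 ∨
    latticeDet (corner v 0) (corner v 1) (corner v 2) = -1
  distinct : ∀ v v', Set.range (corner v) = Set.range (corner v') → v = v'
  face : ∀ v v',
    convexHull ℝ (latticePoint '' Set.range (corner v)) ∩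
      convexHull ℝ (latticePoint '' Set.range (corner v')) =
    convexHull ℝ (latticePoint '' (Set.range (corner v) ∩ Set.range (corner v')))

namespace ToricCY3

/-- The (trivalent) vertices of the toric graph, which is dual to the triangulation: they are the
triangles, that is, the maximal cones, that is, the torus fixed points. -/
abbrev Vertex (Y : ToricCY3) : Type := Fin Y.numVertices

/-- The `j`-th weight vector at the vertex `v` of the toric graph: the linear part of the affine
function on the plane that is `1` at the `j`-th corner of the triangle `v` and `0` at the other
two. This is the weight, on the cotangent space at the fixed point `v`, of the 2-torus that
preserves the holomorphic volume form; it is normal to the side opposite to the `j`-th corner.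
(Indices are taken modulo 3.) -/
def weight (Y : ToricCY3) (v : Y.Vertex) (j : Fin 3) : ℤ × ℤ :=
  let d := latticeDet (Y.corner v 0) (Y.corner v 1) (Y.corner v 2)
  (d * ((Y.corner v (j + 1)).2 - (Y.corner v (j + 2)).2),
   d * ((Y.corner v (j + 2)).1 - (Y.corner v (j + 1)).1))

/-- The weight vector `(a, b)` as the linear form `a t₁ + b t₂`. -/
def weightForm (Y : ToricCY3) (v : Y.Vertex) (j : Fin 3) (t₁ t₂ : ℂ) : ℂ :=
  ((Y.weight v j).1 : ℂ) * t₁ + ((Y.weight v j).2 : ℂ) * t₂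

/-- The equivariant elliptic genus `Z_Y(τ, z; t₁, t₂)`. -/
def ellipticGenus (Y : ToricCY3) (τ z t₁ t₂ : ℂ) : ℂ :=
  ∑ v : Y.Vertex, ∏ j : Fin 3,
    theta1 τ (z + Y.weightForm v j t₁ t₂) / theta1 τ (Y.weightForm v j t₁ t₂)

/-- None of the denominators of the equivariant elliptic genus vanishes. -/
def IsRegular (Y : ToricCY3) (τ t₁ t₂ : ℂ) : Prop :=
  ∀ (v : Y.Vertex) (j : Fin 3), theta1 τ (Y.weightForm v j t₁ t₂) ≠ 0

/-- `Y` is balanced: one can assign to every vertex `v` of the toric graph another vertex `σ v`,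
its balancing vertex, whose weights are, in a suitable ordering, the negatives of those of `v`,
in such a way that different vertices have different balancing vertices. -/
def IsBalanced (Y : ToricCY3) : Prop :=
  ∃ σ : Y.Vertex → Y.Vertex, Function.Injective σ ∧
    ∀ v, σ v ≠ v ∧ ∃ e : Equiv.Perm (Fin 3), ∀ j, Y.weight v j + Y.weight (σ v) (e j) = 0

/-- The rays of the fan; `p` stands for the ray spanned by `(p, 1)`. -/
def rays (Y : ToricCY3) : Finset (ℤ × ℤ) :=
  Finset.univ.image fun vj : Y.Vertex × Fin 3 => Y.corner vj.1 vj.2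

/-- The open subset of `ℂ^rays` of the homogeneous coordinates: the rays whose coordinate
vanishes have to lie in a common cone of the fan. -/
def coxOpen (Y : ToricCY3) : Set (Y.rays → ℂ) :=
  {x | ∃ v : Y.Vertex, ∀ p : Y.rays, x p = 0 → (p : ℤ × ℤ) ∈ Set.range (Y.corner v)}

/-- The subgroup of `(ℂˣ)^rays` that acts on the homogeneous coordinates: the kernel of
`(ℂˣ)^rays → (ℂˣ)³`, `g ↦ ∏ₚ gₚ^{(p, 1)}`. -/
def coxGroup (Y : ToricCY3) : Subgroup (Y.rays → ℂˣ) where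
  carrier := {g | ∏ p, g p ^ (p : ℤ × ℤ).1 = 1 ∧ ∏ p, g p ^ (p : ℤ × ℤ).2 = 1 ∧ ∏ p, g p = 1}
  one_mem' := by simp
  mul_mem' := by
    rintro a b ⟨ha₁, ha₂, ha₃⟩ ⟨hb₁, hb₂, hb₃⟩
    refine ⟨?_, ?_, ?_⟩
    · simp only [Pi.mul_apply, mul_zpow, Finset.prod_mul_distrib, ha₁, hb₁, mul_one]
    · simp only [Pi.mul_apply, mul_zpow, Finset.prod_mul_distrib, ha₂, hb₂, mul_one]
    · simp only [Pi.mul_apply, Finset.prod_mul_distrib, ha₃, hb₃, mul_one]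
  inv_mem' := by
    rintro a ⟨ha₁, ha₂, ha₃⟩
    refine ⟨?_, ?_, ?_⟩
    · simp only [Pi.inv_apply, inv_zpow, Finset.prod_inv_distrib, ha₁, inv_one]
    · simp only [Pi.inv_apply, inv_zpow, Finset.prod_inv_distrib, ha₂, inv_one]
    · simp only [Pi.inv_apply, Finset.prod_inv_distrib, ha₃, inv_one]

/-- Two points of `coxOpen` are equivalent if they lie in the same orbit of `coxGroup`. -/
def coxSetoid (Y : ToricCY3) : Setoid Y.coxOpen where
  r x y := ∃ g ∈ Y.coxGroup, ∀ p, y.1 p = (g p : ℂ) * x.1 p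
  iseqv :=
    { refl := fun x => ⟨1, Y.coxGroup.one_mem, fun p => by simp⟩
      symm := by
        rintro x y ⟨g, hg, h⟩
        exact ⟨g⁻¹, Y.coxGroup.inv_mem hg, fun p => by simp [h p]⟩
      trans := by
        rintro x y z ⟨g, hg, h⟩ ⟨k, hk, h'⟩
        exact ⟨k * g, Y.coxGroup.mul_mem hk hg, fun p => by simp [h p, h' p, mul_assoc]⟩ }

/-- The underlying topological space (in the classical topology) of the toric Calabi-Yau 3-fold,
as the quotient `(ℂ^rays ∖ Z) / G` given by Cox's homogeneous coordinates. -/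
def Space (Y : ToricCY3) : Type := Quotient Y.coxSetoid

instance (Y : ToricCY3) : TopologicalSpace Y.Space :=
  inferInstanceAs (TopologicalSpace (Quotient Y.coxSetoid))

/-- The singular chain complex of the toric Calabi-Yau 3-fold with rational coefficients. -/
def chains (Y : ToricCY3) : ChainComplex (ModuleCat.{0} ℚ) ℕ :=
  ((AlgebraicTopology.singularChainComplexFunctor (ModuleCat.{0} ℚ)).obj (ModuleCat.of ℚ ℚ)).obj
    (TopCat.of Y.Space)

/-- The rational homology is finite-dimensional and vanishes in large degrees, so that the Euler
characteristic makes sense. -/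
def HasFiniteHomology (Y : ToricCY3) : Prop :=
  (∀ k, Module.Finite ℚ (Y.chains.homology k)) ∧
    ∃ N : ℕ, ∀ k, N ≤ k → Subsingleton (Y.chains.homology k)

/-- The topological Euler characteristic `χ(Y) = ∑ₖ (-1)^k dim H_k(Y; ℚ)`. -/
def eulerCharacteristic (Y : ToricCY3) : ℤ :=
  Y.chains.homologyEulerChar

end ToricCY3

end

/-! The theorem has an analytic half and a topological half.

Analytic half. Write `θ` for `θ₁(τ, ·)`. Since `θ` is odd, the contribution of a balancing vertex is
`-∏ θ(z - w_j) / θ(w_j)`, where the `w_j` are the weights at the original vertex. As these weights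
sum to zero, the three-term theta relation, specialised in `theta1_identity`, shows that the
contributions of `v` and `σ v` add up to `θ(2z) / θ(z)`. An injective self-map of a finite set is a
bijection, so summing over all `v` counts every vertex twice: `2 Z_Y = N θ(2z) / θ(z)`, with `N` the
number of triangles (`theta1_mul_ellipticGenus`). At zeros of `θ`, independence of `t₁, t₂` follows
from the identity theorem in `z`. The three-term relation itself is a Plücker relation: by
`theta1_mul_theta1`, `θ(x + y) θ(x - y)` is a 2×2 determinant `f(x) g(y) - g(x) f(y)`.

Topological half: `χ(Y) = N`. In Cox coordinates every triangle gives an open chart `ℂ³`, and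
intersections of charts are charts of common sets of corners. A chart whose set of corners is a
proper subset of a triangle has a factor `ℂˣ`, hence Euler characteristic zero. Gluing the triangles
in one at a time by Mayer-Vietoris therefore adds one each time (`hasEulerChar_chartUnion`).

Mayer-Vietoris (`SingularChains.hasEuler_of_cover`) is proved for singular homology from the theorem
on small chains, that is, by iterated barycentric subdivision. -/

section LongExactSequence

/-! ### Additivity of dimensions along a long exact sequence -/

variable {H₁ H₂ H₃ : ℕ → Type*} [∀ k, AddCommGroup (H₁ k)] [∀ k, AddCommGroup (H₂ k)]
  [∀ k, AddCommGroup (H₃ k)] [∀ k, Module ℚ (H₁ k)] [∀ k, Module ℚ (H₂ k)] [∀ k, Module ℚ (H₃ k)]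
  {f : ∀ k, H₁ k →ₗ[ℚ] H₂ k} {g : ∀ k, H₂ k →ₗ[ℚ] H₃ k} {δ : ∀ k, H₃ (k + 1) →ₗ[ℚ] H₁ k}

lemma finite_of_range_eq_ker {U V W : Type*} [AddCommGroup U] [AddCommGroup V] [AddCommGroup W]
    [Module ℚ U] [Module ℚ V] [Module ℚ W] [Module.Finite ℚ U] [Module.Finite ℚ W]
    {a : U →ₗ[ℚ] V} {b : V →ₗ[ℚ] W} (h : a.range = b.ker) : Module.Finite ℚ V := by
  have h1 : b.ker.FG := by rw [← h]; exact Module.Finite.iff_fg.1 inferInstance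
  refine ⟨Submodule.fg_of_fg_map_of_fg_inf_ker b ?_ (by rwa [top_inf_eq])⟩
  exact IsNoetherian.noetherian _

lemma subsingleton_of_range_eq_ker {U V W : Type*} [AddCommGroup U] [AddCommGroup V]
    [AddCommGroup W] [Module ℚ U] [Module ℚ V] [Module ℚ W] [Subsingleton U] [Subsingleton W]
    {a : U →ₗ[ℚ] V} {b : V →ₗ[ℚ] W} (h : a.range = b.ker) : Subsingleton V := by
  refine subsingleton_of_forall_eq 0 fun v => ?_
  have : v ∈ a.range := by rw [h]; exact Subsingleton.elim _ _
  obtain ⟨u, rfl⟩ := this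
  rw [Subsingleton.elim u 0, map_zero]

lemma euler_of_longExact [∀ k, Module.Finite ℚ (H₁ k)] [∀ k, Module.Finite ℚ (H₂ k)]
    [∀ k, Module.Finite ℚ (H₃ k)] (h₁ : ∀ k, (δ k).range = (f k).ker)
    (h₂ : ∀ k, (f k).range = (g k).ker) (h₃ : ∀ k, (g (k + 1)).range = (δ k).ker)
    (h₀ : (g 0).range = ⊤) (N : ℕ) (hN : Subsingleton (H₃ N)) :
    ∑ k ∈ Finset.range N, (-1 : ℤ) ^ k * (Module.finrank ℚ (H₂ k) : ℤ) =
      ∑ k ∈ Finset.range N, (-1 : ℤ) ^ k * (Module.finrank ℚ (H₁ k) : ℤ) +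
      ∑ k ∈ Finset.range N, (-1 : ℤ) ^ k * (Module.finrank ℚ (H₃ k) : ℤ) := by
  have e₁ k := (f k).finrank_range_add_finrank_ker
  have e₂ k := (g k).finrank_range_add_finrank_ker
  have e₃ k := (δ k).finrank_range_add_finrank_ker
  -- By exactness the error term is `(-1)^n` times the rank of the connecting map leaving `H₃ n`; it
  -- vanishes at `n = 0` because `g 0` is onto, and at `N` because `H₃ N = 0`.
  have key : ∀ n, ∑ k ∈ Finset.range n, (-1 : ℤ) ^ k * (Module.finrank ℚ (H₂ k) : ℤ) =
      ∑ k ∈ Finset.range n, (-1 : ℤ) ^ k * (Module.finrank ℚ (H₁ k) : ℤ) +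
      ∑ k ∈ Finset.range n, (-1 : ℤ) ^ k * (Module.finrank ℚ (H₃ k) : ℤ) +
      (-1) ^ n * ((Module.finrank ℚ (H₃ n) : ℤ) - Module.finrank ℚ (g n).range) := by
    intro n
    induction n with
    | zero => rw [h₀, finrank_top]; simp
    | succ n ih =>
      rw [Finset.sum_range_succ, Finset.sum_range_succ, Finset.sum_range_succ, ih]
      have a := e₁ n
      have b := e₂ n
      have c := e₃ n
      rw [← h₁] at a
      rw [← h₂] at b
      rw [← h₃] at c
      zify at a b c
      rw [pow_succ]
      linear_combination (-1 : ℤ) ^ n * (a - b - c)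
  rw [key N, Module.finrank_zero_of_subsingleton,
    Module.finrank_zero_of_subsingleton (M := (g N).range)]
  simp

end LongExactSequence

/-! ### Euler characteristics of rational chain complexes -/

namespace ChainComplex

open CategoryTheory Limits

/-- The homology is finite-dimensional and bounded, with Euler characteristic `e`. -/
def HasEuler (K : ChainComplex (ModuleCat.{0} ℚ) ℕ) (e : ℤ) : Prop :=
  (∀ k, Module.Finite ℚ (K.homology k)) ∧
    (∃ N : ℕ, ∀ k, N ≤ k → Subsingleton (K.homology k)) ∧ K.homologyEulerChar = e

lemma homologyEulerChar_eq_sum_range (K : ChainComplex (ModuleCat.{0} ℚ) ℕ) (N : ℕ)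
    (h : ∀ k, N ≤ k → Subsingleton (K.homology k)) :
    K.homologyEulerChar =
      ∑ k ∈ Finset.range N, (-1 : ℤ) ^ k * (Module.finrank ℚ (K.homology k) : ℤ) := by
  rw [HomologicalComplex.homologyEulerChar_eq_sum_finSet_of_finrankSupport_subset K
    (Finset.range N)]
  · refine Finset.sum_congr rfl fun k _ => ?_
    simp [ComplexShape.χ]
  · intro k hk
    by_contra hk'
    have := h k (by simpa using hk')
    exact hk Module.finrank_zero_of_subsingleton

lemma HasEuler.of_iso {K L : ChainComplex (ModuleCat.{0} ℚ) ℕ} {e : ℤ} (h : K.HasEuler e)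
    (i : ∀ k, K.homology k ≅ L.homology k) : L.HasEuler e := by
  obtain ⟨h1, ⟨N, hN⟩, h3⟩ := h
  have hN' : ∀ k, N ≤ k → Subsingleton (L.homology k) := fun k hk =>
    have := hN k hk
    (i k).toLinearEquiv.symm.injective.subsingleton
  refine ⟨fun k => have := h1 k; Module.Finite.equiv (i k).toLinearEquiv, ⟨N, hN'⟩, ?_⟩
  rw [← h3, homologyEulerChar_eq_sum_range _ N hN, homologyEulerChar_eq_sum_range _ N hN']
  exact Finset.sum_congr rfl fun k _ => by rw [(i k).toLinearEquiv.finrank_eq]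

lemma hasEuler_zero {K : ChainComplex (ModuleCat.{0} ℚ) ℕ}
    (h : ∀ k, Subsingleton (K.homology k)) : K.HasEuler 0 := by
  refine ⟨fun k => have := h k; inferInstance, ⟨0, fun k _ => h k⟩, ?_⟩
  rw [homologyEulerChar_eq_sum_range _ 0 fun k _ => h k]
  simp

/-- In degree zero every chain is a cycle, so `H₀` is a quotient of the chains. This closes the long
exact sequence on the right. -/
lemma surjective_homologyMap_zero {K L : ChainComplex (ModuleCat.{0} ℚ) ℕ} (g : K ⟶ L)
    [Epi (g.f 0)] : (HomologicalComplex.homologyMap g 0).hom.range = ⊤ := by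
  have := L.isIso_iCycles 0 0 (by simp) (by simp)
  have := K.isIso_iCycles 0 0 (by simp) (by simp)
  have h1 : Epi (HomologicalComplex.cyclesMap g 0) := by
    have : Epi (HomologicalComplex.cyclesMap g 0 ≫ L.iCycles 0) := by
      rw [HomologicalComplex.cyclesMap_i]; exact epi_comp _ _
    rw [← Category.comp_id (HomologicalComplex.cyclesMap g 0), ← IsIso.hom_inv_id (L.iCycles 0),
      ← Category.assoc]
    exact epi_comp _ _
  have h2 : Epi (K.homologyπ 0 ≫ HomologicalComplex.homologyMap g 0) := by
    rw [HomologicalComplex.homologyπ_naturality]; exact epi_comp _ _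
  have h3 : Epi (HomologicalComplex.homologyMap g 0) := epi_of_epi (K.homologyπ 0) _
  exact LinearMap.range_eq_top.2 ((ModuleCat.epi_iff_surjective _).1 h3)

section ShortExact

variable {S : ShortComplex (ChainComplex (ModuleCat.{0} ℚ) ℕ)} {a b : ℤ}

lemma homologyMap_range_eq_ker (hS : S.ShortExact) (k : ℕ) :
    (HomologicalComplex.homologyMap S.f k).hom.range =
      (HomologicalComplex.homologyMap S.g k).hom.ker :=
  (hS.homology_exact₂ k).moduleCat_range_eq_ker

lemma euler_of_shortExact (hS : S.ShortExact)
    (f₁ : ∀ k, Module.Finite ℚ (S.X₁.homology k))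
    (f₂ : ∀ k, Module.Finite ℚ (S.X₂.homology k)) (f₃ : ∀ k, Module.Finite ℚ (S.X₃.homology k))
    {N : ℕ} (n₁ : ∀ k, N ≤ k → Subsingleton (S.X₁.homology k))
    (n₂ : ∀ k, N ≤ k → Subsingleton (S.X₂.homology k))
    (n₃ : ∀ k, N ≤ k → Subsingleton (S.X₃.homology k)) :
    S.X₂.homologyEulerChar = S.X₁.homologyEulerChar + S.X₃.homologyEulerChar := by
  rw [homologyEulerChar_eq_sum_range _ N n₁, homologyEulerChar_eq_sum_range _ N n₂,
    homologyEulerChar_eq_sum_range _ N n₃]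
  have := hS.epi_g
  have : Epi (S.g.f 0) := inferInstance
  exact euler_of_longExact
    (fun k => (hS.homology_exact₁ (k + 1) k rfl).moduleCat_range_eq_ker)
    (fun k => homologyMap_range_eq_ker hS k)
    (fun k => (hS.homology_exact₃ (k + 1) k rfl).moduleCat_range_eq_ker)
    (surjective_homologyMap_zero S.g) N (n₃ N le_rfl)

lemma HasEuler.middle (hS : S.ShortExact)
    (h₁ : S.X₁.HasEuler a) (h₃ : S.X₃.HasEuler b) :
    S.X₂.HasEuler (a + b) := by
  obtain ⟨f₁, ⟨N₁, n₁⟩, rfl⟩ := h₁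
  obtain ⟨f₃, ⟨N₃, n₃⟩, rfl⟩ := h₃
  have f₂ : ∀ k, Module.Finite ℚ (S.X₂.homology k) := fun k =>
    finite_of_range_eq_ker (homologyMap_range_eq_ker hS k)
  have n₂ : ∀ k, max N₁ N₃ ≤ k → Subsingleton (S.X₂.homology k) := fun k hk =>
    have := n₁ k (le_of_max_le_left hk)
    have := n₃ k (le_of_max_le_right hk)
    subsingleton_of_range_eq_ker (homologyMap_range_eq_ker hS k)
  exact ⟨f₂, ⟨_, n₂⟩, euler_of_shortExact hS f₁ f₂ f₃ (fun k hk => n₁ k (le_of_max_le_left hk)) n₂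
    (fun k hk => n₃ k (le_of_max_le_right hk))⟩

lemma HasEuler.right (hS : S.ShortExact)
    (h₁ : S.X₁.HasEuler a) (h₂ : S.X₂.HasEuler b) :
    S.X₃.HasEuler (b - a) := by
  obtain ⟨f₁, ⟨N₁, n₁⟩, rfl⟩ := h₁
  obtain ⟨f₂, ⟨N₂, n₂⟩, rfl⟩ := h₂
  have f₃ : ∀ k, Module.Finite ℚ (S.X₃.homology k) := by
    rintro (_ | k)
    · have := hS.epi_g
      have : Epi (S.g.f 0) := inferInstance
      exact Module.Finite.of_surjective _
        (LinearMap.range_eq_top.1 (surjective_homologyMap_zero S.g))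
    · exact finite_of_range_eq_ker (hS.homology_exact₃ (k + 1) k rfl).moduleCat_range_eq_ker
  have n₃ : ∀ k, max N₁ N₂ + 1 ≤ k → Subsingleton (S.X₃.homology k) := by
    rintro (_ | k) hk
    · omega
    · have := n₁ k (by omega)
      have := n₂ (k + 1) (by omega)
      exact subsingleton_of_range_eq_ker
        (hS.homology_exact₃ (k + 1) k rfl).moduleCat_range_eq_ker
  refine ⟨f₃, ⟨_, n₃⟩, ?_⟩
  rw [euler_of_shortExact hS f₁ f₂ f₃ (fun k hk => n₁ k (by omega)) (fun k hk => n₂ k (by omega))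
    n₃]
  ring

end ShortExact

end ChainComplex

/-! ### Singular chains and their basis of singular simplices -/

namespace SingularChains

open CategoryTheory Limits AlgebraicTopology Simplicial

/-- The singular chain complex with rational coefficients. -/
noncomputable def chainsQ (X : TopCat.{0}) : ChainComplex (ModuleCat.{0} ℚ) ℕ :=
  ((singularChainComplexFunctor (ModuleCat.{0} ℚ)).obj (ModuleCat.of ℚ ℚ)).obj X

/-- The chain map induced by a continuous map. -/
noncomputable def chainsMap {X Y : TopCat.{0}} (f : X ⟶ Y) : chainsQ X ⟶ chainsQ Y :=
  ((singularChainComplexFunctor (ModuleCat.{0} ℚ)).obj (ModuleCat.of ℚ ℚ)).map f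

/-- The singular simplices of a space. -/
abbrev Simp (n : ℕ) (X : Type) [TopologicalSpace X] := C(stdSimplex ℝ (Fin (n + 1)), X)

section SSet

variable (S : SSet.{0}) (n : ℕ)

/-- The coordinates of a simplicial chain. -/
noncomputable def toFinsupp :
    (S.chainComplex (ModuleCat.of ℚ ℚ)).X n ⟶ ModuleCat.of ℚ (S _⦋n⦌ →₀ ℚ) :=
  (S.isColimitChainComplexXCofan (ModuleCat.of ℚ ℚ) n).desc
      (Cofan.mk (ModuleCat.of ℚ (S _⦋n⦌ →₀ ℚ))
        fun x => ModuleCat.ofHom (Finsupp.lsingle x))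

lemma ι_toFinsupp (x : S _⦋n⦌) :
    S.ιChainComplex x ≫ toFinsupp S n = ModuleCat.ofHom (Finsupp.lsingle x) :=
  (S.isColimitChainComplexXCofan (ModuleCat.of ℚ ℚ) n).fac _ ⟨x⟩

/-- The simplicial chain with given coordinates. -/
noncomputable def ofFinsupp :
    ModuleCat.of ℚ (S _⦋n⦌ →₀ ℚ) ⟶ (S.chainComplex (ModuleCat.of ℚ ℚ)).X n :=
  ModuleCat.ofHom (Finsupp.lsum ℚ fun x => (S.ιChainComplex (R := ModuleCat.of ℚ ℚ) x).hom)

/-- Simplicial chains are finite linear combinations of simplices. -/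
noncomputable def isoFinsupp :
    (S.chainComplex (ModuleCat.of ℚ ℚ)).X n ≅ ModuleCat.of ℚ (S _⦋n⦌ →₀ ℚ) where
  hom := toFinsupp S n
  inv := ofFinsupp S n
  hom_inv_id := by
    refine SSet.chainComplex_hom_ext fun x => ?_
    rw [← Category.assoc, ι_toFinsupp]
    refine ModuleCat.hom_ext (LinearMap.ext_ring ?_)
    change (Finsupp.lsum ℚ fun x => (S.ιChainComplex (R := ModuleCat.of ℚ ℚ) x).hom)
      (Finsupp.single x (1 : ℚ)) = _
    rw [Finsupp.lsum_single]
    rfl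
  inv_hom_id := by
    refine ModuleCat.hom_ext (Finsupp.lhom_ext' fun x => LinearMap.ext_ring ?_)
    change (toFinsupp S n).hom
      ((Finsupp.lsum ℚ fun x => (S.ιChainComplex (R := ModuleCat.of ℚ ℚ) x).hom)
        (Finsupp.single x (1 : ℚ))) = Finsupp.single x (1 : ℚ)
    rw [Finsupp.lsum_single]
    exact congrArg (fun f => f.hom (1 : ℚ)) (ι_toFinsupp S n x)

/-- The basis of the simplicial chains given by the simplices. -/
noncomputable def simplexBasis :
    Module.Basis (S _⦋n⦌) ℚ ((S.chainComplex (ModuleCat.of ℚ ℚ)).X n) :=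
  ⟨(isoFinsupp S n).toLinearEquiv⟩

lemma simplexBasis_apply (x : S _⦋n⦌) :
    simplexBasis S n x = (S.ιChainComplex (R := ModuleCat.of ℚ ℚ) x).hom (1 : ℚ) := by
  change (Finsupp.lsum ℚ fun x => (S.ιChainComplex (R := ModuleCat.of ℚ ℚ) x).hom)
      (Finsupp.single x (1 : ℚ)) = _
  rw [Finsupp.lsum_single]

end SSet

variable {X Y : Type} [TopologicalSpace X] [TopologicalSpace Y]

/-- The singular simplex `σ` as an element of the singular simplicial set. -/
noncomputable def toSimplex {n : ℕ} (σ : Simp n X) : (TopCat.toSSet.obj (TopCat.of X)) _⦋n⦌ :=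
  ((TopCat.of X).toSSetObjEquiv (Opposite.op ⦋n⦌)).symm σ

/-- The basis of the singular chains given by the singular simplices. -/
noncomputable def sing (X : Type) [TopologicalSpace X] (n : ℕ) :
    Module.Basis (Simp n X) ℚ ((chainsQ (TopCat.of X)).X n) :=
  (simplexBasis (TopCat.toSSet.obj (TopCat.of X)) n).reindex
    ((TopCat.of X).toSSetObjEquiv (Opposite.op ⦋n⦌))

lemma sing_apply {n : ℕ} (σ : Simp n X) : sing X n σ =
    ((TopCat.toSSet.obj (TopCat.of X)).ιChainComplex (R := ModuleCat.of ℚ ℚ)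
      (toSimplex σ)).hom (1 : ℚ) := by
  have h := Module.Basis.reindex_apply (simplexBasis (TopCat.toSSet.obj (TopCat.of X)) n)
    ((TopCat.of X).toSSetObjEquiv (Opposite.op ⦋n⦌)) σ
  exact h.trans (simplexBasis_apply _ _ _)

/-- The `i`-th face inclusion of the standard simplex. -/
noncomputable def faceMap {n : ℕ} (i : Fin (n + 2)) :
    C(stdSimplex ℝ (Fin (n + 1)), stdSimplex ℝ (Fin (n + 2))) :=
  ⟨stdSimplex.map i.succAbove, stdSimplex.continuous_map _⟩

lemma sing_d {n : ℕ} (σ : Simp (n + 1) X) :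
    ((chainsQ (TopCat.of X)).d (n + 1) n).hom (sing X (n + 1) σ) =
      ∑ i : Fin (n + 2), (-1 : ℚ) ^ (i : ℕ) • sing X n (σ.comp (faceMap i)) := by
  rw [sing_apply]
  have := congrArg (fun f => f.hom (1 : ℚ))
    (SSet.ιChainComplex_d (TopCat.toSSet.obj (TopCat.of X)) (ModuleCat.of ℚ ℚ) (toSimplex σ))
  simp only [ModuleCat.hom_comp, LinearMap.comp_apply] at this
  refine this.trans ?_
  rw [ModuleCat.hom_sum, LinearMap.sum_apply]
  refine Finset.sum_congr rfl fun i _ => ?_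
  rw [sing_apply, ModuleCat.hom_zsmul, LinearMap.smul_apply]
  have : (TopCat.toSSet.obj (TopCat.of X)).δ i (toSimplex σ) = toSimplex (σ.comp (faceMap i)) := rfl
  rw [this, ← Int.cast_smul_eq_zsmul ℚ]
  push_cast
  rfl

lemma chainsMap_sing {n : ℕ} (f : C(X, Y)) (σ : Simp n X) :
    ((chainsMap (TopCat.ofHom f)).f n).hom (sing X n σ) = sing Y n (f.comp σ) := by
  rw [sing_apply, sing_apply]
  exact congrArg (fun g : ModuleCat.of ℚ ℚ ⟶ (chainsQ (TopCat.of Y)).X n => g.hom (1 : ℚ))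
    (SSet.ι_chainComplexMap_f _ _ (TopCat.toSSet.map (TopCat.ofHom f)) (ModuleCat.of ℚ ℚ)
      (toSimplex σ))

end SingularChains

/-! ### Barycentric subdivision of formal tuples -/

namespace Subdivision

variable (E : Type*)

/-- Formal linear combinations of ordered `n`-tuples of points. -/
abbrev Tuples (n : ℕ) := (Fin n → E) →₀ ℚ

variable {E}

/-- The alternating sum of the faces of a tuple, as a linear map. -/
noncomputable def bdry (n : ℕ) : Tuples E (n + 1) →ₗ[ℚ] Tuples E n :=
  Finsupp.linearCombination ℚ fun v =>
    ∑ i : Fin (n + 1), (-1 : ℚ) ^ (i : ℕ) • Finsupp.single (v ∘ i.succAbove) 1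

lemma bdry_single (n : ℕ) (v : Fin (n + 1) → E) : bdry n (Finsupp.single v 1) =
    ∑ i : Fin (n + 1), (-1 : ℚ) ^ (i : ℕ) • Finsupp.single (v ∘ i.succAbove) (1 : ℚ) := by
  simp [bdry]

/-- The cone with apex `b`. -/
noncomputable def cone (b : E) (n : ℕ) : Tuples E n →ₗ[ℚ] Tuples E (n + 1) :=
  Finsupp.lmapDomain ℚ ℚ fun v => (Fin.cons b v : Fin (n + 1) → E)

lemma cone_single (b : E) (n : ℕ) (v : Fin n → E) (c : ℚ) :
    cone b n (Finsupp.single v c) = Finsupp.single (Fin.cons b v) c := by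
  simp [cone]

lemma bdry_cone_zero (b : E) (x : Tuples E 0) : bdry 0 (cone b 0 x) = x := by
  suffices bdry 0 ∘ₗ cone b 0 = LinearMap.id from LinearMap.congr_fun this x
  ext v : 2
  simp only [LinearMap.comp_apply, Finsupp.lsingle_apply, cone_single, bdry_single]
  rw [Fin.sum_univ_one, Subsingleton.elim (_ ∘ _) v]
  simp

/-- Deleting the apex gives back the tuple; deleting any other point gives the cone over a face,
with the sign shifted by one. All later chain identities are deduced from this formula. -/
lemma bdry_cone (b : E) (n : ℕ) (x : Tuples E (n + 1)) :
    bdry (n + 1) (cone b (n + 1) x) = x - cone b n (bdry n x) := by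
  suffices bdry (n + 1) ∘ₗ cone b (n + 1) = LinearMap.id - cone b n ∘ₗ bdry n from
    LinearMap.congr_fun this x
  ext v : 2
  simp only [LinearMap.comp_apply, Finsupp.lsingle_apply, cone_single, bdry_single,
    LinearMap.sub_apply, LinearMap.id_apply]
  rw [Fin.sum_univ_succ, map_sum, sub_eq_add_neg, ← Finset.sum_neg_distrib]
  congr 1
  · simp
  · refine Finset.sum_congr rfl fun i _ => ?_
    rw [map_smul, cone_single, ← neg_smul]
    congr 1
    · simp [pow_succ]
    · congr 1
      ext j
      refine Fin.cases ?_ (fun j => ?_) j <;> simp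

/-- Every non-empty tuple is the cone over its tail, so the cone formula reduces the claim to the
tail. -/
lemma bdry_bdry (n : ℕ) (x : Tuples E (n + 2)) : bdry n (bdry (n + 1) x) = 0 := by
  suffices bdry n ∘ₗ bdry (n + 1) = (0 : Tuples E (n + 2) →ₗ[ℚ] Tuples E n) from
    LinearMap.congr_fun this x
  clear x
  induction n with
  | zero =>
    ext v : 2
    simp only [LinearMap.comp_apply, Finsupp.lsingle_apply, LinearMap.zero_apply]
    rw [← Fin.cons_self_tail v, ← cone_single, bdry_cone, map_sub, bdry_cone_zero, sub_self]
  | succ n ih =>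
    ext v : 2
    have := LinearMap.congr_fun ih (Finsupp.single (Fin.tail v) 1)
    simp only [LinearMap.comp_apply, Finsupp.lsingle_apply, LinearMap.zero_apply] at this ⊢
    rw [← Fin.cons_self_tail v, ← cone_single, bdry_cone, map_sub, bdry_cone, this, map_zero,
      sub_zero, sub_self]

-- The chain identities are formal and hold for any `β`; geometry enters only through naturality and
-- the mesh estimate. The index counts points, so tuples of index `n + 1` have simplicial degree
-- `n`, and index `0` is the augmentation.
variable (β : ∀ n : ℕ, (Fin (n + 1) → E) → E)

/-- Barycentric subdivision of tuples, with respect to a choice of the barycenters. -/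
noncomputable def sd : ∀ n : ℕ, Tuples E n →ₗ[ℚ] Tuples E n
  | 0 => LinearMap.id
  | n + 1 => Finsupp.linearCombination ℚ fun v =>
      cone (β n v) n (sd n (bdry n (Finsupp.single v 1)))

/-- The chain homotopy between barycentric subdivision and the identity. -/
noncomputable def sdHomotopy : ∀ n : ℕ, Tuples E n →ₗ[ℚ] Tuples E (n + 1)
  | 0 => 0
  | n + 1 => Finsupp.linearCombination ℚ fun v =>
      cone (β n v) (n + 1) (Finsupp.single v 1 - sdHomotopy n (bdry n (Finsupp.single v 1)))

lemma sd_single (n : ℕ) (v : Fin (n + 1) → E) : sd β (n + 1) (Finsupp.single v 1) =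
    cone (β n v) n (sd β n (bdry n (Finsupp.single v 1))) := by
  simp [sd]

lemma sdHomotopy_single (n : ℕ) (v : Fin (n + 1) → E) :
    sdHomotopy β (n + 1) (Finsupp.single v 1) =
    cone (β n v) (n + 1) (Finsupp.single v 1 - sdHomotopy β n (bdry n (Finsupp.single v 1))) := by
  simp [sdHomotopy]

/-- Write `S`, `T` for subdivision and homotopy. The cone formula gives `∂Tv = (v - T∂v) - cone(∂(v
- T∂v))`, and the inductive hypothesis at `∂v`, with `∂∂ = 0`, turns `∂(v - T∂v)` into `S∂v`, whose
cone is `Sv`. -/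
lemma bdry_sdHomotopy (n : ℕ) (x : Tuples E (n + 1)) :
    bdry (n + 1) (sdHomotopy β (n + 1) x) + sdHomotopy β n (bdry n x) = x - sd β (n + 1) x := by
  suffices bdry (n + 1) ∘ₗ sdHomotopy β (n + 1) + sdHomotopy β n ∘ₗ bdry n =
    LinearMap.id - sd β (n + 1) from LinearMap.congr_fun this x
  clear x
  induction n with
  | zero =>
    ext v : 2
    simp only [LinearMap.comp_apply, Finsupp.lsingle_apply, LinearMap.add_apply,
      LinearMap.sub_apply, LinearMap.id_apply]
    rw [sdHomotopy_single, sd_single, bdry_cone]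
    simp [sdHomotopy, sd]
  | succ n ih =>
    ext v : 2
    have := LinearMap.congr_fun ih (bdry (n + 1) (Finsupp.single v 1))
    simp only [LinearMap.comp_apply, Finsupp.lsingle_apply, LinearMap.add_apply,
      LinearMap.sub_apply, LinearMap.id_apply] at this ⊢
    rw [sdHomotopy_single, sd_single, bdry_cone, map_sub (bdry (n + 1))]
    rw [bdry_bdry, map_zero, add_zero] at this
    rw [this]
    simp only [map_sub]
    abel

section Naturality

variable {F : Type*} (f : E → F)

/-- The map on tuples induced by a map of points. -/
noncomputable def push (n : ℕ) : Tuples E n →ₗ[ℚ] Tuples F n :=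
  Finsupp.lmapDomain ℚ ℚ (f ∘ ·)

lemma push_single (n : ℕ) (v : Fin n → E) (c : ℚ) :
    push f n (Finsupp.single v c) = Finsupp.single (f ∘ v) c := by
  simp [push]

lemma push_bdry (n : ℕ) (x : Tuples E (n + 1)) :
    push f n (bdry n x) = bdry n (push f (n + 1) x) := by
  suffices push f n ∘ₗ bdry n = bdry n ∘ₗ push f (n + 1) from LinearMap.congr_fun this x
  ext v : 2
  simp only [LinearMap.comp_apply, Finsupp.lsingle_apply, push_single, bdry_single, map_sum,
    map_smul]
  rfl

lemma push_cone (b : E) (n : ℕ) (x : Tuples E n) :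
    push f (n + 1) (cone b n x) = cone (f b) n (push f n x) := by
  suffices push f (n + 1) ∘ₗ cone b n = cone (f b) n ∘ₗ push f n from LinearMap.congr_fun this x
  ext v : 2
  simp only [LinearMap.comp_apply, Finsupp.lsingle_apply, push_single, cone_single]
  congr 1
  ext j
  refine Fin.cases ?_ (fun j => ?_) j <;> simp

variable {β} {β' : ∀ n : ℕ, (Fin (n + 1) → F) → F} {f}

lemma push_sd (hf : ∀ n v, f (β n v) = β' n (f ∘ v)) (n : ℕ) (x : Tuples E n) :
    push f n (sd β n x) = sd β' n (push f n x) := by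
  suffices push f n ∘ₗ sd β n = sd β' n ∘ₗ push f n from LinearMap.congr_fun this x
  clear x
  induction n with
  | zero => rfl
  | succ n ih =>
    ext v : 2
    have := LinearMap.congr_fun ih (bdry n (Finsupp.single v 1))
    simp only [LinearMap.comp_apply, Finsupp.lsingle_apply] at this ⊢
    rw [sd_single, push_cone, this, push_single, sd_single, push_bdry, push_single, hf]

lemma push_sdHomotopy (hf : ∀ n v, f (β n v) = β' n (f ∘ v)) (n : ℕ) (x : Tuples E n) :
    push f (n + 1) (sdHomotopy β n x) = sdHomotopy β' n (push f n x) := by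
  suffices push f (n + 1) ∘ₗ sdHomotopy β n = sdHomotopy β' n ∘ₗ push f n from
    LinearMap.congr_fun this x
  clear x
  induction n with
  | zero => simp [sdHomotopy]
  | succ n ih =>
    ext v : 2
    have := LinearMap.congr_fun ih (bdry n (Finsupp.single v 1))
    simp only [LinearMap.comp_apply, Finsupp.lsingle_apply] at this ⊢
    rw [sdHomotopy_single, push_cone, map_sub, this, push_single, sdHomotopy_single, push_bdry,
      push_single, hf]

end Naturality

end Subdivision

/-! ### Subdivision of singular chains -/

namespace SingularChains

open Subdivision

/-- The affine simplex with given vertices. -/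
noncomputable def affine {k n : ℕ} (v : Fin (k + 1) → stdSimplex ℝ (Fin (n + 1))) :
    C(stdSimplex ℝ (Fin (k + 1)), stdSimplex ℝ (Fin (n + 1))) where
  toFun t := ⟨∑ i, t i • (v i : Fin (n + 1) → ℝ),
    (convex_stdSimplex ℝ (Fin (n + 1))).sum_mem (fun i _ => t.2.1 i) t.2.2 fun i _ => (v i).2⟩
  continuous_toFun := by
    refine Continuous.subtype_mk (continuous_finsetSum _ fun i _ => ?_) _
    exact ((continuous_apply i).comp continuous_subtype_val).smul continuous_const

lemma affine_coe {k n : ℕ} (v : Fin (k + 1) → stdSimplex ℝ (Fin (n + 1)))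
    (t : stdSimplex ℝ (Fin (k + 1))) (j : Fin (n + 1)) :
    affine v t j = ∑ i, t i * v i j := by
  change (∑ i, t i • (v i : Fin (n + 1) → ℝ)) j = _
  simp only [Finset.sum_apply, Pi.smul_apply, smul_eq_mul]

lemma affine_vertex {k n : ℕ} (v : Fin (k + 1) → stdSimplex ℝ (Fin (n + 1))) (i : Fin (k + 1)) :
    affine v (stdSimplex.vertex i) = v i := by
  ext j
  rw [affine_coe]
  simp [Pi.single_apply]

lemma affine_comp_affine {k m n : ℕ} (w : Fin (m + 1) → stdSimplex ℝ (Fin (n + 1)))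
    (v : Fin (k + 1) → stdSimplex ℝ (Fin (m + 1))) :
    (affine w).comp (affine v) = affine (affine w ∘ v) := by
  ext t j
  simp only [ContinuousMap.comp_apply, affine_coe, Function.comp_apply, Finset.sum_mul,
    Finset.mul_sum]
  rw [Finset.sum_comm]
  simp only [mul_assoc]

lemma affine_vertices (n : ℕ) :
    affine (fun i : Fin (n + 1) => (stdSimplex.vertex i : stdSimplex ℝ (Fin (n + 1)))) =
      ContinuousMap.id _ := by
  ext t j
  rw [affine_coe]
  simp [Pi.single_apply]

lemma faceMap_eq_affine {n : ℕ} (i : Fin (n + 2)) :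
    faceMap i = affine fun j : Fin (n + 1) =>
      (stdSimplex.vertex (i.succAbove j) : stdSimplex ℝ (Fin (n + 2))) := by
  ext t j
  rw [affine_coe]
  change stdSimplex.map i.succAbove t j = _
  rw [stdSimplex.map_coe, FunOnFinite.linearMap_apply_apply, Finset.sum_filter]
  simp [Pi.single_apply, eq_comm]

lemma affine_comp_faceMap {k n : ℕ} (v : Fin (k + 2) → stdSimplex ℝ (Fin (n + 1)))
    (i : Fin (k + 2)) : (affine v).comp (faceMap i) = affine (v ∘ i.succAbove) := by
  rw [faceMap_eq_affine, affine_comp_affine]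
  congr 1
  ext1 j
  exact affine_vertex v _

/-- The barycenter of a tuple of points of a simplex. -/
noncomputable def bary (n k : ℕ) (v : Fin (k + 1) → stdSimplex ℝ (Fin (n + 1))) :
    stdSimplex ℝ (Fin (n + 1)) :=
  affine v stdSimplex.barycenter

lemma affine_bary {k m n : ℕ} (w : Fin (m + 1) → stdSimplex ℝ (Fin (n + 1)))
    (v : Fin (k + 1) → stdSimplex ℝ (Fin (m + 1))) :
    affine w (bary m k v) = bary n k (affine w ∘ v) :=
  DFunLike.congr_fun (affine_comp_affine w v) _

/-- The generator of the tuples given by the vertices of the standard simplex. -/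
noncomputable def vertices (n : ℕ) : Tuples (stdSimplex ℝ (Fin (n + 1))) (n + 1) :=
  Finsupp.single (fun i => stdSimplex.vertex i) 1

variable {X Y : Type} [TopologicalSpace X] [TopologicalSpace Y]

/-- The singular chain given by a combination of affine simplices in a singular simplex. -/
noncomputable def realize {n : ℕ} (σ : Simp n X) (k : ℕ) :
    Tuples (stdSimplex ℝ (Fin (n + 1))) (k + 1) →ₗ[ℚ] (chainsQ (TopCat.of X)).X k :=
  Finsupp.linearCombination ℚ fun v => sing X k (σ.comp (affine v))

lemma realize_single {n : ℕ} (σ : Simp n X) (k : ℕ)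
    (v : Fin (k + 1) → stdSimplex ℝ (Fin (n + 1))) :
    realize σ k (Finsupp.single v 1) = sing X k (σ.comp (affine v)) := by
  simp [realize]

lemma realize_vertices {n : ℕ} (σ : Simp n X) : realize σ n (vertices n) = sing X n σ := by
  rw [vertices, realize_single, affine_vertices, ContinuousMap.comp_id]

lemma d_realize {n : ℕ} (σ : Simp n X) (k : ℕ)
    (x : Tuples (stdSimplex ℝ (Fin (n + 1))) (k + 2)) :
    ((chainsQ (TopCat.of X)).d (k + 1) k).hom (realize σ (k + 1) x) =
      realize σ k (bdry (k + 1) x) := by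
  suffices ((chainsQ (TopCat.of X)).d (k + 1) k).hom ∘ₗ realize σ (k + 1) =
    realize σ k ∘ₗ bdry (k + 1) from LinearMap.congr_fun this x
  ext v : 2
  simp only [LinearMap.comp_apply, Finsupp.lsingle_apply]
  rw [realize_single, sing_d, bdry_single, map_sum]
  refine Finset.sum_congr rfl fun i _ => ?_
  rw [map_smul, realize_single, ContinuousMap.comp_assoc, affine_comp_faceMap]

lemma realize_comp_affine {m n : ℕ} (σ : Simp n X) (w : Fin (m + 1) → stdSimplex ℝ (Fin (n + 1)))
    (k : ℕ) (x : Tuples (stdSimplex ℝ (Fin (m + 1))) (k + 1)) :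
    realize (σ.comp (affine w)) k x = realize σ k (push (affine w) (k + 1) x) := by
  suffices realize (σ.comp (affine w)) k = realize σ k ∘ₗ push (affine w) (k + 1) from
    LinearMap.congr_fun this x
  ext v : 2
  simp only [LinearMap.comp_apply, Finsupp.lsingle_apply]
  rw [realize_single, push_single, realize_single, ContinuousMap.comp_assoc, affine_comp_affine]

lemma push_affine_vertices {m n : ℕ} (w : Fin (m + 1) → stdSimplex ℝ (Fin (n + 1))) :
    push (affine w) (m + 1) (vertices m) = Finsupp.single w 1 := by
  rw [vertices, push_single]
  congr 1
  ext1 i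
  exact affine_vertex w i

/-- Barycentric subdivision of singular chains. -/
noncomputable def subdivide (X : Type) [TopologicalSpace X] (n : ℕ) :
    (chainsQ (TopCat.of X)).X n →ₗ[ℚ] (chainsQ (TopCat.of X)).X n :=
  (sing X n).constr ℚ fun σ => realize σ n (sd (bary n) (n + 1) (vertices n))

/-- The chain homotopy between barycentric subdivision and the identity. -/
noncomputable def subdivideHomotopy (X : Type) [TopologicalSpace X] (n : ℕ) :
    (chainsQ (TopCat.of X)).X n →ₗ[ℚ] (chainsQ (TopCat.of X)).X (n + 1) :=
  (sing X n).constr ℚ fun σ => realize σ (n + 1) (sdHomotopy (bary n) (n + 1) (vertices n))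

/-- Affine maps preserve barycenters, so subdividing the standard simplex and then mapping it by an
affine map agrees with subdividing the image tuple. This transports the formal identities to
singular chains. -/
lemma subdivide_realize {n : ℕ} (σ : Simp n X) (k : ℕ)
    (x : Tuples (stdSimplex ℝ (Fin (n + 1))) (k + 1)) :
    subdivide X k (realize σ k x) = realize σ k (sd (bary n) (k + 1) x) := by
  suffices subdivide X k ∘ₗ realize σ k = realize σ k ∘ₗ sd (bary n) (k + 1) from
    LinearMap.congr_fun this x
  ext v : 2
  simp only [LinearMap.comp_apply, Finsupp.lsingle_apply]
  rw [realize_single, subdivide, Module.Basis.constr_basis, realize_comp_affine,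
    push_sd (β' := bary n) (fun _ => affine_bary v), push_affine_vertices]

lemma subdivideHomotopy_realize {n : ℕ} (σ : Simp n X) (k : ℕ)
    (x : Tuples (stdSimplex ℝ (Fin (n + 1))) (k + 1)) :
    subdivideHomotopy X k (realize σ k x) =
      realize σ (k + 1) (sdHomotopy (bary n) (k + 1) x) := by
  suffices subdivideHomotopy X k ∘ₗ realize σ k =
    realize σ (k + 1) ∘ₗ sdHomotopy (bary n) (k + 1) from LinearMap.congr_fun this x
  ext v : 2
  simp only [LinearMap.comp_apply, Finsupp.lsingle_apply]
  rw [realize_single, subdivideHomotopy, Module.Basis.constr_basis, realize_comp_affine,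
    push_sdHomotopy (β' := bary n) (fun _ => affine_bary v), push_affine_vertices]

lemma d_subdivideHomotopy_succ (n : ℕ) (c : (chainsQ (TopCat.of X)).X (n + 1)) :
    ((chainsQ (TopCat.of X)).d (n + 2) (n + 1)).hom (subdivideHomotopy X (n + 1) c) +
      subdivideHomotopy X n (((chainsQ (TopCat.of X)).d (n + 1) n).hom c) =
      c - subdivide X (n + 1) c := by
  suffices ((chainsQ (TopCat.of X)).d (n + 2) (n + 1)).hom ∘ₗ subdivideHomotopy X (n + 1) +
      subdivideHomotopy X n ∘ₗ ((chainsQ (TopCat.of X)).d (n + 1) n).hom =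
      LinearMap.id - subdivide X (n + 1) from LinearMap.congr_fun this c
  refine (sing X (n + 1)).ext fun σ => ?_
  simp only [LinearMap.add_apply, LinearMap.comp_apply, LinearMap.sub_apply, LinearMap.id_apply]
  rw [← realize_vertices, subdivideHomotopy_realize, d_realize, d_realize,
    subdivideHomotopy_realize, subdivide_realize, ← map_add, bdry_sdHomotopy, map_sub]

lemma d_subdivideHomotopy_zero (c : (chainsQ (TopCat.of X)).X 0) :
    ((chainsQ (TopCat.of X)).d 1 0).hom (subdivideHomotopy X 0 c) = c - subdivide X 0 c := by
  suffices ((chainsQ (TopCat.of X)).d 1 0).hom ∘ₗ subdivideHomotopy X 0 =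
      LinearMap.id - subdivide X 0 from LinearMap.congr_fun this c
  refine (sing X 0).ext fun σ => ?_
  simp only [LinearMap.comp_apply, LinearMap.sub_apply, LinearMap.id_apply]
  rw [← realize_vertices, subdivideHomotopy_realize, d_realize, subdivide_realize, ← map_sub,
    ← bdry_sdHomotopy]
  -- The augmentation term of the formal identity disappears because the homotopy is zero on empty
  -- tuples.
  simp [sdHomotopy]

end SingularChains

/-! ### Subdivision shrinks the mesh -/

namespace Subdivision

variable {E : Type*}

lemma single_mem_supported {ι : Type*} {s : Set ι} {v : ι} (hv : v ∈ s) (c : ℚ) :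
    Finsupp.single v c ∈ Finsupp.supported ℚ ℚ s :=
  Finsupp.single_mem_supported ℚ c hv

lemma map_mem_of_mem_supported {ι : Type*} {M : Type*} [AddCommGroup M] [Module ℚ M]
    {s : Set ι} {p : Submodule ℚ M} {f : (ι →₀ ℚ) →ₗ[ℚ] M}
    (h : ∀ v ∈ s, f (Finsupp.single v 1) ∈ p) {x : ι →₀ ℚ} (hx : x ∈ Finsupp.supported ℚ ℚ s) :
    f x ∈ p := by
  rw [Finsupp.supported_eq_span_single] at hx
  have : Submodule.span ℚ ((fun i => Finsupp.single i (1 : ℚ)) '' s) ≤ p.comap f := by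
    rw [Submodule.span_le]
    rintro _ ⟨v, hv, rfl⟩
    exact h v hv
  exact this hx

lemma cone_mem_supported {b : E} {n : ℕ} {s : Set (Fin n → E)} {t : Set (Fin (n + 1) → E)}
    (h : ∀ v ∈ s, (Fin.cons b v : Fin (n + 1) → E) ∈ t) {x : Tuples E n}
    (hx : x ∈ Finsupp.supported ℚ ℚ s) : cone b n x ∈ Finsupp.supported ℚ ℚ t :=
  map_mem_of_mem_supported (fun v hv => by
    rw [cone_single]; exact single_mem_supported (h v hv) _) hx

lemma bdry_single_mem_supported {n : ℕ} {v : Fin (n + 1) → E} {t : Set (Fin n → E)}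
    (h : ∀ i : Fin (n + 1), v ∘ i.succAbove ∈ t) :
    bdry n (Finsupp.single v 1) ∈ Finsupp.supported ℚ ℚ t := by
  rw [bdry_single]
  exact Submodule.sum_mem _ fun i _ => Submodule.smul_mem _ _ (single_mem_supported (h i) _)

variable {β : ∀ n : ℕ, (Fin (n + 1) → E) → E}

lemma sd_mem_supported {C : Set E} (hC : ∀ n v, (∀ i, v i ∈ C) → β n v ∈ C) (n : ℕ)
    {x : Tuples E n} (hx : x ∈ Finsupp.supported ℚ ℚ {v | ∀ i, v i ∈ C}) :
    sd β n x ∈ Finsupp.supported ℚ ℚ {v | ∀ i, v i ∈ C} := by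
  induction n with
  | zero => exact hx
  | succ n ih =>
    refine map_mem_of_mem_supported (fun v hv => ?_) hx
    rw [sd_single]
    refine cone_mem_supported (fun w hw i => ?_)
      (ih (bdry_single_mem_supported fun i j => hv (i.succAbove j)))
    refine Fin.cases ?_ (fun j => ?_) i
    · exact hC n v hv
    · exact hw j

variable [PseudoMetricSpace E]

/-- The tuples whose points are pairwise at distance at most `r`. -/
def meshSet (E : Type*) [PseudoMetricSpace E] (n : ℕ) (r : ℝ) : Set (Fin n → E) :=
  {v | ∀ i j, dist (v i) (v j) ≤ r}

/-- Two points of a subdivided simplex either both lie in a subdivided face, where induction applies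
with the smaller factor, or one of them is the barycenter `β n v`. In the second case the other
point stays in the ball around `β n v` that contains the original points, since balls are closed
under barycenters. -/
lemma sd_mem_mesh (hC : ∀ (b : E) (r : ℝ) n v, (∀ i, dist (v i) b ≤ r) → dist (β n v) b ≤ r)
    (hβ : ∀ (r : ℝ) n v, v ∈ meshSet E (n + 1) r →
      ∀ i, dist (v i) (β n v) ≤ (n / (n + 1) : ℝ) * r)
    {r : ℝ} (hr : 0 ≤ r) (n : ℕ) {x : Tuples E (n + 1)}
    (hx : x ∈ Finsupp.supported ℚ ℚ (meshSet E (n + 1) r)) :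
    sd β (n + 1) x ∈ Finsupp.supported ℚ ℚ (meshSet E (n + 1) ((n / (n + 1) : ℝ) * r)) := by
  induction n generalizing r with
  | zero =>
    refine map_mem_of_mem_supported (fun v hv => ?_) hx
    rw [sd_single]
    refine cone_mem_supported (s := Set.univ) (fun w _ i j => ?_) (by simp)
    rw [Subsingleton.elim (α := Fin 1) i j]; simp
  | succ n ih =>
    refine map_mem_of_mem_supported (fun v hv => ?_) hx
    rw [sd_single]
    have h1 := ih hr (bdry_single_mem_supported (v := v) (t := meshSet E (n + 1) r)
      fun i j k => hv _ _)
    have h2 := sd_mem_supported (β := β)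
      (C := {y | dist y (β (n + 1) v) ≤ (↑(n + 1) / (↑(n + 1) + 1) : ℝ) * r})
      (fun m w hw => hC _ _ m w hw) (n + 1)
      (bdry_single_mem_supported (v := v) fun i j => hβ r (n + 1) v hv _)
    have h3 := Submodule.mem_inf.2 ⟨h1, h2⟩
    rw [← Finsupp.supported_inter] at h3
    have hle : (n / (n + 1) : ℝ) * r ≤ (↑(n + 1) / (↑(n + 1) + 1) : ℝ) * r := by
      refine mul_le_mul_of_nonneg_right ?_ hr
      push_cast
      rw [div_le_div_iff₀ (by positivity) (by positivity)]
      nlinarith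
    refine cone_mem_supported (fun w hw i j => ?_) h3
    obtain ⟨hw1, hw2⟩ := hw
    induction i using Fin.cases with
    | zero =>
      induction j using Fin.cases with
      | zero => simp only [dist_self]; positivity
      | succ j => rw [dist_comm]; exact hw2 j
    | succ i =>
      induction j using Fin.cases with
      | zero => exact hw2 i
      | succ j => exact (hw1 i j).trans hle

end Subdivision

/-! ### Small chains -/

namespace SingularChains

open Subdivision

lemma dist_affine_le {k n : ℕ} {v : Fin (k + 1) → stdSimplex ℝ (Fin (n + 1))}
    {b : stdSimplex ℝ (Fin (n + 1))} {r : ℝ} (h : ∀ i, dist (v i) b ≤ r)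
    (t : stdSimplex ℝ (Fin (k + 1))) : dist (affine v t) b ≤ r :=
  (convex_closedBall (b : Fin (n + 1) → ℝ) r).sum_mem (fun i _ => t.2.1 i) t.2.2 fun i _ => h i

lemma dist_bary_le {n : ℕ} (r : ℝ) (k : ℕ) (v : Fin (k + 1) → stdSimplex ℝ (Fin (n + 1)))
    (hv : v ∈ meshSet (stdSimplex ℝ (Fin (n + 1))) (k + 1) r) (i : Fin (k + 1)) :
    dist (v i) (bary n k v) ≤ (k / (k + 1) : ℝ) * r := by
  have hk : (0 : ℝ) < k + 1 := by positivity
  -- Of these `k + 1` terms the one with `j = i` vanishes; the other `k` give the factor `k / (k +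
  -- 1)`.
  have h0 : (v i).1 - (bary n k v).1 =
      ∑ j, ((k + 1 : ℝ)⁻¹) • ((v i).1 - (v j).1) := by
    rw [← Finset.smul_sum, Finset.sum_sub_distrib, smul_sub]
    congr 1
    · simp only [Finset.sum_const, Finset.card_univ, Fintype.card_fin]
      rw [← Nat.cast_smul_eq_nsmul ℝ, smul_smul]
      push_cast
      rw [inv_mul_cancel₀ hk.ne', one_smul]
    · change (∑ j, (stdSimplex.barycenter : stdSimplex ℝ (Fin (k + 1))).1 j • (v j).1) = _
      rw [Finset.smul_sum]
      refine Finset.sum_congr rfl fun j _ => ?_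
      congr 1
      rw [stdSimplex.barycenter_apply]
      simp
  have h1 : dist (v i) (bary n k v) = ‖(v i).1 - (bary n k v).1‖ :=
    dist_eq_norm (v i).1 (bary n k v).1
  rw [h1, h0]
  refine (norm_sum_le _ _).trans ?_
  have h2 : ∀ j ∈ Finset.univ.erase i,
      ‖((k + 1 : ℝ)⁻¹) • ((v i).1 - (v j).1)‖ ≤ (k + 1 : ℝ)⁻¹ * r := by
    intro j _
    rw [norm_smul, Real.norm_of_nonneg (by positivity)]
    refine mul_le_mul_of_nonneg_left ?_ (by positivity)
    rw [← dist_eq_norm]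
    exact hv i j
  rw [← Finset.add_sum_erase _ _ (Finset.mem_univ i)]
  have h3 := Finset.sum_le_card_nsmul _ _ _ h2
  rw [Finset.card_erase_of_mem (Finset.mem_univ i)] at h3
  simp only [sub_self, smul_zero, norm_zero, zero_add]
  refine h3.trans (le_of_eq ?_)
  simp
  field_simp

variable {X : Type} [TopologicalSpace X]

/-- The singular chains that are combinations of simplices each of which lies in one of two
subsets. -/
noncomputable def smallChains (A B : Set X) (n : ℕ) : Submodule ℚ ((chainsQ (TopCat.of X)).X n) :=
  Submodule.span ℚ (sing X n '' {σ | (∀ t, σ t ∈ A) ∨ (∀ t, σ t ∈ B)})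

/-- Every simplex that occurs is `σ` composed with an affine map, so it stays in whichever set
contains the image of `σ`. -/
lemma subdivideHomotopy_mem_smallChains {A B : Set X} {n : ℕ} {c : (chainsQ (TopCat.of X)).X n}
    (hc : c ∈ smallChains A B n) : subdivideHomotopy X n c ∈ smallChains A B (n + 1) := by
  have : smallChains A B n ≤ (smallChains A B (n + 1)).comap (subdivideHomotopy X n) := by
    refine Submodule.span_le.2 ?_
    rintro _ ⟨σ, hσ, rfl⟩
    change subdivideHomotopy X n (sing X n σ) ∈ smallChains A B (n + 1)
    rw [subdivideHomotopy, Module.Basis.constr_basis]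
    refine map_mem_of_mem_supported (s := Set.univ) (fun v _ => ?_) (by simp)
    rw [realize_single]
    exact Submodule.subset_span ⟨_, hσ.imp (fun h t => h _) (fun h t => h _), rfl⟩
  exact this hc

lemma exists_sd_mem_mesh (n : ℕ) {δ : ℝ} (hδ : 0 < δ) :
    ∃ m : ℕ, ((sd (bary n) (n + 1))^[m] (vertices n)) ∈
      Finsupp.supported ℚ ℚ (meshSet (stdSimplex ℝ (Fin (n + 1))) (n + 1) δ) := by
  set D := Metric.diam (Set.univ : Set (stdSimplex ℝ (Fin (n + 1))))
  have key : ∀ m : ℕ, ((sd (bary n) (n + 1))^[m] (vertices n)) ∈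
      Finsupp.supported ℚ ℚ (meshSet (stdSimplex ℝ (Fin (n + 1))) (n + 1)
        ((n / (n + 1) : ℝ) ^ m * D)) := by
    intro m
    induction m with
    | zero =>
      refine single_mem_supported (fun i j => ?_) _
      rw [pow_zero, one_mul]
      exact Metric.dist_le_diam_of_mem isCompact_univ.isBounded trivial trivial
    | succ m ih =>
      rw [Function.iterate_succ_apply', pow_succ', mul_assoc]
      refine sd_mem_mesh (fun b r k v h => dist_affine_le h _) (fun r k v h => dist_bary_le r k v h)
        (mul_nonneg (by positivity) Metric.diam_nonneg) n ih
  have hlt : (n / (n + 1) : ℝ) < 1 := by rw [div_lt_one (by positivity)]; linarith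
  have htend : Filter.Tendsto (fun m : ℕ => (n / (n + 1) : ℝ) ^ m * D) Filter.atTop (nhds 0) := by
    simpa using (tendsto_pow_atTop_nhds_zero_of_lt_one (by positivity) hlt).mul_const D
  obtain ⟨m, hm⟩ := (htend.eventually (gt_mem_nhds hδ)).exists
  exact ⟨m, Finsupp.supported_mono (fun v hv i j => (hv i j).trans hm.le) (key m)⟩

lemma subdivide_iterate_realize {n : ℕ} (σ : Simp n X) (m : ℕ)
    (x : Tuples (stdSimplex ℝ (Fin (n + 1))) (n + 1)) :
    (subdivide X n)^[m] (realize σ n x) = realize σ n ((sd (bary n) (n + 1))^[m] x) := by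
  induction m with
  | zero => rfl
  | succ m ih => rw [Function.iterate_succ_apply', ih, subdivide_realize,
      Function.iterate_succ_apply']

lemma subdivide_mem_smallChains {A B : Set X} {n : ℕ} {c : (chainsQ (TopCat.of X)).X n}
    (hc : c ∈ smallChains A B n) : subdivide X n c ∈ smallChains A B n := by
  have : smallChains A B n ≤ (smallChains A B n).comap (subdivide X n) := by
    refine Submodule.span_le.2 ?_
    rintro _ ⟨σ, hσ, rfl⟩
    change subdivide X n (sing X n σ) ∈ smallChains A B n
    rw [subdivide, Module.Basis.constr_basis]
    refine map_mem_of_mem_supported (s := Set.univ) (fun v _ => ?_) (by simp)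
    rw [realize_single]
    exact Submodule.subset_span ⟨_, hσ.imp (fun h t => h _) (fun h t => h _), rfl⟩
  exact this hc

/-- Take a Lebesgue number `δ` of the cover of the standard simplex pulled back along `σ`. Once the
mesh is at most `δ / 2`, each affine piece lies in the open ball of radius `δ` about its first
vertex. -/
lemma exists_subdivide_sing_mem {A B : Set X} (hA : IsOpen A) (hB : IsOpen B)
    (hAB : A ∪ B = Set.univ) {n : ℕ} (σ : Simp n X) :
    ∃ m, (subdivide X n)^[m] (sing X n σ) ∈ smallChains A B n := by
  obtain ⟨δ, hδ, h⟩ := lebesgue_number_lemma_of_metric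
    (s := (Set.univ : Set (stdSimplex ℝ (Fin (n + 1))))) (c := fun i : Bool => σ ⁻¹' cond i A B)
    isCompact_univ (by rintro (_ | _) <;> [exact hB.preimage σ.continuous;
      exact hA.preimage σ.continuous]) (by
      intro t _
      have : σ t ∈ A ∪ B := by rw [hAB]; trivial
      rw [Set.mem_iUnion]
      exact this.elim (fun h => ⟨true, h⟩) (fun h => ⟨false, h⟩))
  obtain ⟨m, hm⟩ := exists_sd_mem_mesh n (half_pos hδ)
  refine ⟨m, ?_⟩
  rw [← realize_vertices, subdivide_iterate_realize]
  refine map_mem_of_mem_supported (fun v hv => ?_) hm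
  rw [realize_single]
  refine Submodule.subset_span ⟨_, ?_, rfl⟩
  obtain ⟨i, hi⟩ := h (v 0) trivial
  have hmem : ∀ t, (σ.comp (affine v)) t ∈ cond i A B := fun t =>
    hi (lt_of_le_of_lt (dist_affine_le (fun j => hv j 0) t) (half_lt_self hδ))
  cases i
  · exact Or.inr hmem
  · exact Or.inl hmem

lemma exists_subdivide_mem {A B : Set X} (hA : IsOpen A) (hB : IsOpen B)
    (hAB : A ∪ B = Set.univ) {n : ℕ} (c : (chainsQ (TopCat.of X)).X n) :
    ∃ m, (subdivide X n)^[m] c ∈ smallChains A B n := by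
  have hmono : ∀ (c : (chainsQ (TopCat.of X)).X n) (m k : ℕ),
      (subdivide X n)^[m] c ∈ smallChains A B n →
      (subdivide X n)^[k + m] c ∈ smallChains A B n := by
    intro c m k h
    induction k with
    | zero => rwa [zero_add]
    | succ k ih =>
      rw [Nat.succ_add, Function.iterate_succ_apply']
      exact subdivide_mem_smallChains ih
  induction (sing X n).mem_span c using Submodule.span_induction with
  | mem x hx =>
    obtain ⟨σ, rfl⟩ := hx
    exact exists_subdivide_sing_mem hA hB hAB σ
  | zero => exact ⟨0, Submodule.zero_mem _⟩
  | add x y _ _ hx hy =>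
    obtain ⟨m, hm⟩ := hx
    obtain ⟨k, hk⟩ := hy
    -- Small chains stay small under further subdivision, so the sum of the two exponents serves
    -- both summands.
    refine ⟨k + m, ?_⟩
    rw [iterate_map_add]
    exact Submodule.add_mem _ (hmono x m k hm) (by rw [add_comm]; exact hmono y k m hk)
  | smul a x _ hx =>
    obtain ⟨m, hm⟩ := hx
    refine ⟨m, ?_⟩
    rw [← Module.End.pow_apply, map_smul, Module.End.pow_apply]
    exact Submodule.smul_mem _ a hm

end SingularChains

/-! ### The Mayer-Vietoris principle for Euler characteristics -/

namespace SingularChains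

open CategoryTheory Limits AlgebraicTopology

section Cokernel

variable {J K P : ChainComplex (ModuleCat.{0} ℚ) ℕ} {j : J ⟶ K} {κ : K ⟶ P}

/-- Split `κ` through its image: `0 → J → K → im κ → 0` and `0 → im κ → P → coker κ → 0`, where the
last term is acyclic. -/
lemma hasEuler_of_kernel_of_cokernel [Mono j] {w : j ≫ κ = 0}
    (hex : (ShortComplex.mk j κ w).Exact) {a b : ℤ} (hJ : J.HasEuler a) (hK : K.HasEuler b)
    (hQ : ∀ k, Subsingleton ((cokernel κ).homology k)) : P.HasEuler (b - a) := by
  have w₁ : j ≫ Abelian.factorThruImage κ = 0 := by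
    rw [← cancel_mono (Abelian.image.ι κ), Category.assoc, Abelian.image.fac, w, zero_comp]
  have hS₁ : (ShortComplex.mk j (Abelian.factorThruImage κ) w₁).ShortExact := by
    refine ShortComplex.ShortExact.mk' ?_ inferInstance inferInstance
    let φ : ShortComplex.mk j (Abelian.factorThruImage κ) w₁ ⟶ ShortComplex.mk j κ w :=
      { τ₁ := 𝟙 _, τ₂ := 𝟙 _, τ₃ := Abelian.image.ι κ }
    have : Epi φ.τ₁ := inferInstanceAs (Epi (𝟙 J))
    have : IsIso φ.τ₂ := inferInstanceAs (IsIso (𝟙 K))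
    have : Mono φ.τ₃ := inferInstanceAs (Mono (Abelian.image.ι κ))
    exact (ShortComplex.exact_iff_of_epi_of_isIso_of_mono φ).2 hex
  have hS₂ : (ShortComplex.mk (Abelian.image.ι κ) (cokernel.π κ)
      (kernel.condition _)).ShortExact := by
    refine ShortComplex.ShortExact.mk' ?_ inferInstance inferInstance
    exact ShortComplex.exact_of_f_is_kernel _ (kernelIsKernel (cokernel.π κ))
  have := ChainComplex.HasEuler.middle hS₂ (ChainComplex.HasEuler.right hS₁ hJ hK)
    (ChainComplex.hasEuler_zero hQ)
  simpa using this

end Cokernel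

variable {X Y : Type} [TopologicalSpace X] [TopologicalSpace Y]

lemma chainsMap_repr {n : ℕ} (f : C(Y, X)) (x : (chainsQ (TopCat.of Y)).X n) :
    (sing X n).repr (((chainsMap (TopCat.ofHom f)).f n).hom x) =
      Finsupp.mapDomain (fun σ => f.comp σ) ((sing Y n).repr x) := by
  suffices (sing X n).repr.toLinearMap ∘ₗ ((chainsMap (TopCat.ofHom f)).f n).hom =
    Finsupp.lmapDomain ℚ ℚ (fun σ => f.comp σ) ∘ₗ (sing Y n).repr.toLinearMap from
    LinearMap.congr_fun this x
  refine (sing Y n).ext fun σ => ?_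
  simp only [LinearMap.comp_apply, LinearEquiv.coe_coe]
  rw [chainsMap_sing, Module.Basis.repr_self, Module.Basis.repr_self, Finsupp.lmapDomain_apply,
    Finsupp.mapDomain_single]

lemma chainsMap_injective {n : ℕ} {f : C(Y, X)} (hf : Function.Injective f) :
    Function.Injective ((chainsMap (TopCat.ofHom f)).f n).hom := by
  intro x y h
  have h' := congrArg (sing X n).repr h
  rw [chainsMap_repr, chainsMap_repr] at h'
  refine (sing Y n).repr.injective (Finsupp.mapDomain_injective ?_ h')
  intro σ τ h
  ext t
  exact hf (DFunLike.congr_fun h t)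

instance {f : TopCat.of Y ⟶ TopCat.of X} [Mono f] : Mono (chainsMap f) :=
  inferInstanceAs (Mono (((singularChainComplexFunctor (ModuleCat.{0} ℚ)).obj
    (ModuleCat.of ℚ ℚ)).map f))

/-- The inclusion of a subset. -/
def incl (A : Set X) : C(A, X) := ⟨Subtype.val, continuous_subtype_val⟩

/-- The inclusion of a subset into a larger one. -/
def inclusion {A B : Set X} (h : A ⊆ B) : C(A, B) := ⟨Set.inclusion h, continuous_inclusion h⟩

/-- The chains that are combinations of simplices in a subset. -/
noncomputable def chainsIn (A : Set X) (n : ℕ) : Submodule ℚ ((chainsQ (TopCat.of X)).X n) :=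
  Submodule.span ℚ (sing X n '' {σ | ∀ t, σ t ∈ A})

lemma range_chainsMap_incl (A : Set X) (n : ℕ) :
    ((chainsMap (TopCat.ofHom (incl A))).f n).hom.range = chainsIn A n := by
  rw [LinearMap.range_eq_map, ← (sing A n).span_eq, Submodule.map_span, ← Set.range_comp]
  congr 1
  ext x
  constructor
  · rintro ⟨σ, rfl⟩
    exact ⟨(incl A).comp σ, fun t => (σ t).2, (chainsMap_sing _ _).symm⟩
  · rintro ⟨σ, hσ, rfl⟩
    exact ⟨⟨fun t => ⟨σ t, hσ t⟩, by fun_prop⟩, chainsMap_sing _ _⟩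

/-- Both sides are spanned by parts of one basis, so membership is read off from the support of the
coordinates. -/
lemma chainsIn_inf (A B : Set X) (n : ℕ) : chainsIn A n ⊓ chainsIn B n = chainsIn (A ∩ B) n := by
  ext x
  rw [Submodule.mem_inf, chainsIn, chainsIn, chainsIn, Module.Basis.mem_span_image,
    Module.Basis.mem_span_image, Module.Basis.mem_span_image, ← Set.subset_inter_iff]
  have : {σ : Simp n X | ∀ t, σ t ∈ A} ∩ {σ | ∀ t, σ t ∈ B} = {σ | ∀ t, σ t ∈ A ∩ B} := by
    ext σ
    exact forall_and.symm
  rw [this]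

lemma chainsIn_sup (A B : Set X) (n : ℕ) : chainsIn A n ⊔ chainsIn B n = smallChains A B n := by
  rw [chainsIn, chainsIn, smallChains, ← Submodule.span_union, ← Set.image_union]
  rfl

section MayerVietoris

variable {A B : Set X}

/-- The identity `c - Sc = dTc + Tdc` makes `c` and `Sc` agree up to a boundary and the small chain
`Tdc`; iterate until the subdivided chain is small. The boundary of `Sc` remains small, so the
hypothesis is inherited. -/
lemma exists_sub_d_mem_succ (hA : IsOpen A) (hB : IsOpen B) (hAB : A ∪ B = Set.univ)
    (n : ℕ) (c : (chainsQ (TopCat.of X)).X (n + 1))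
    (hc : ((chainsQ (TopCat.of X)).d (n + 1) n).hom c ∈ smallChains A B n) :
    ∃ e, c - ((chainsQ (TopCat.of X)).d (n + 2) (n + 1)).hom e ∈ smallChains A B (n + 1) := by
  obtain ⟨m, hm⟩ := exists_subdivide_mem hA hB hAB c
  induction m generalizing c with
  | zero => exact ⟨0, by simpa using hm⟩
  | succ m ih =>
    have h1 := d_subdivideHomotopy_succ n c
    have h2 : ((chainsQ (TopCat.of X)).d (n + 1) n).hom (subdivide X (n + 1) c) ∈
        smallChains A B n := by
      have h3 : subdivide X (n + 1) c = c - (c - subdivide X (n + 1) c) := by abel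
      rw [h3, ← h1, map_sub, map_add]
      have h4 : ((chainsQ (TopCat.of X)).d (n + 1) n).hom
          (((chainsQ (TopCat.of X)).d (n + 2) (n + 1)).hom (subdivideHomotopy X (n + 1) c)) = 0 :=
        congrArg (fun f => f.hom (subdivideHomotopy X (n + 1) c))
          ((chainsQ (TopCat.of X)).d_comp_d (n + 2) (n + 1) n)
      have h5 : ((chainsQ (TopCat.of X)).d (n + 1) n).hom (subdivideHomotopy X n
          (((chainsQ (TopCat.of X)).d (n + 1) n).hom c)) ∈ smallChains A B n := by
        cases n with
        | zero =>
          rw [d_subdivideHomotopy_zero]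
          exact Submodule.sub_mem _ hc (subdivide_mem_smallChains hc)
        | succ n =>
          have h6 := d_subdivideHomotopy_succ n (((chainsQ (TopCat.of X)).d (n + 2) (n + 1)).hom c)
          have h7 : ((chainsQ (TopCat.of X)).d (n + 1) n).hom
              (((chainsQ (TopCat.of X)).d (n + 2) (n + 1)).hom c) = 0 :=
            congrArg (fun f => f.hom c) ((chainsQ (TopCat.of X)).d_comp_d (n + 2) (n + 1) n)
          rw [h7, map_zero, add_zero] at h6
          rw [h6]
          exact Submodule.sub_mem _ hc (subdivide_mem_smallChains hc)
      rw [h4, zero_add]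
      exact Submodule.sub_mem _ hc h5
    obtain ⟨e, he⟩ := ih _ h2 (by rwa [Function.iterate_succ_apply] at hm)
    refine ⟨e + subdivideHomotopy X (n + 1) c, ?_⟩
    have h8 : c - ((chainsQ (TopCat.of X)).d (n + 2) (n + 1)).hom
        (e + subdivideHomotopy X (n + 1) c) =
        (subdivide X (n + 1) c - ((chainsQ (TopCat.of X)).d (n + 2) (n + 1)).hom e) +
        subdivideHomotopy X n (((chainsQ (TopCat.of X)).d (n + 1) n).hom c) := by
      rw [map_add, eq_sub_of_add_eq h1]
      abel
    rw [h8]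
    exact Submodule.add_mem _ he (subdivideHomotopy_mem_smallChains hc)

lemma exists_sub_d_mem_zero (hA : IsOpen A) (hB : IsOpen B) (hAB : A ∪ B = Set.univ)
    (c : (chainsQ (TopCat.of X)).X 0) :
    ∃ e, c - ((chainsQ (TopCat.of X)).d 1 0).hom e ∈ smallChains A B 0 := by
  obtain ⟨m, hm⟩ := exists_subdivide_mem hA hB hAB c
  induction m generalizing c with
  | zero => exact ⟨0, by simpa using hm⟩
  | succ m ih =>
    obtain ⟨e, he⟩ := ih (subdivide X 0 c) (by rwa [Function.iterate_succ_apply] at hm)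
    refine ⟨e + subdivideHomotopy X 0 c, ?_⟩
    rw [map_add, d_subdivideHomotopy_zero]
    convert he using 1
    abel

/-- The quotient by the small chains is acyclic: a cycle of the quotient lifts to a chain with small
boundary, which is small up to a boundary. -/
lemma subsingleton_homology_of_ker_eq (hA : IsOpen A) (hB : IsOpen B) (hAB : A ∪ B = Set.univ)
    {Q : ChainComplex (ModuleCat.{0} ℚ) ℕ}
    (ρ : chainsQ (TopCat.of X) ⟶ Q) (hρ : ∀ n, Function.Surjective (ρ.f n).hom)
    (hker : ∀ n, (ρ.f n).hom.ker = smallChains A B n) (k : ℕ) : Subsingleton (Q.homology k) := by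
  have hmem : ∀ {n} {c : (chainsQ (TopCat.of X)).X n},
      c ∈ smallChains A B n ↔ (ρ.f n).hom c = 0 := fun {n c} => by
    rw [← hker, LinearMap.mem_ker]
  have hcomm : ∀ (m n : ℕ) (c : (chainsQ (TopCat.of X)).X m),
      (Q.d m n).hom ((ρ.f m).hom c) = (ρ.f n).hom (((chainsQ (TopCat.of X)).d m n).hom c) :=
    fun m n c => congrArg (fun f => f.hom c) (ρ.comm m n)
  rw [← ModuleCat.isZero_iff_subsingleton]
  refine HomologicalComplex.ExactAt.isZero_homology ?_
  cases k with
  | zero =>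
    rw [Q.exactAt_iff' 1 0 0 (by simp) (by simp), ShortComplex.moduleCat_exact_iff]
    intro q _
    obtain ⟨c, rfl⟩ := hρ 0 q
    obtain ⟨e, he⟩ := exists_sub_d_mem_zero hA hB hAB c
    rw [hmem, map_sub, sub_eq_zero] at he
    exact ⟨(ρ.f 1).hom e, (hcomm 1 0 e).trans he.symm⟩
  | succ n =>
    rw [Q.exactAt_iff' (n + 2) (n + 1) n (by simp) (by simp), ShortComplex.moduleCat_exact_iff]
    intro q hq
    obtain ⟨c, rfl⟩ := hρ (n + 1) q
    have hc : ((chainsQ (TopCat.of X)).d (n + 1) n).hom c ∈ smallChains A B n := by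
      rw [hmem, ← hcomm]; exact hq
    obtain ⟨e, he⟩ := exists_sub_d_mem_succ hA hB hAB n c hc
    rw [hmem, map_sub, sub_eq_zero] at he
    exact ⟨(ρ.f (n + 2)).hom e, (hcomm (n + 2) (n + 1) e).trans he.symm⟩

/-- Mayer-Vietoris for Euler characteristics, for an open cover of a space. -/
theorem hasEuler_of_cover (hA : IsOpen A) (hB : IsOpen B) (hAB : A ∪ B = Set.univ)
    {a b c : ℤ} (ha : (chainsQ (TopCat.of A)).HasEuler a)
    (hb : (chainsQ (TopCat.of B)).HasEuler b)
    (hc : (chainsQ (TopCat.of ↥(A ∩ B))).HasEuler c) :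
    (chainsQ (TopCat.of X)).HasEuler (a + (b - c)) := by
  let iA := chainsMap (TopCat.ofHom (incl A))
  let iB := chainsMap (TopCat.ofHom (incl B))
  let ι := inclusion (A := A ∩ B) (B := B) Set.inter_subset_right
  let j := chainsMap (TopCat.ofHom ι)
  have hA' : Mono (TopCat.ofHom (incl A)) := (TopCat.mono_iff_injective _).2 Subtype.val_injective
  have hι : Mono (TopCat.ofHom ι) :=
    (TopCat.mono_iff_injective _).2 (Set.inclusion_injective Set.inter_subset_right)
  have hiA : Mono iA := inferInstanceAs (Mono (chainsMap (TopCat.ofHom (incl A))))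
  have hj : Mono j := inferInstanceAs (Mono (chainsMap _))
  let π := cokernel.π iA
  have hS : (ShortComplex.mk iA π (cokernel.condition iA)).ShortExact :=
    ShortComplex.ShortExact.mk'
      (ShortComplex.exact_of_g_is_cokernel _ (cokernelIsCokernel iA)) hiA inferInstance
  have hπ : ∀ n (x : (chainsQ (TopCat.of X)).X n), (π.f n).hom x = 0 ↔ x ∈ chainsIn A n := by
    intro n x
    have := ((HomologicalComplex.exact_iff_degreewise_exact _).1 hS.exact n).moduleCat_range_eq_ker
    rw [← range_chainsMap_incl]
    exact (SetLike.ext_iff.1 this x).symm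
  have hji : ∀ n (x : (chainsQ (TopCat.of ↥(A ∩ B))).X n), (iB.f n).hom ((j.f n).hom x) =
      ((chainsMap (TopCat.ofHom (incl (A ∩ B)))).f n).hom x := by
    intro n x
    refine LinearMap.congr_fun (f := (iB.f n).hom ∘ₗ (j.f n).hom) ((sing _ n).ext fun σ => ?_) x
    rw [LinearMap.comp_apply, chainsMap_sing, chainsMap_sing, chainsMap_sing]
    rfl
  -- The map `C(B) → C(X)/C(A)` has kernel `C(A ∩ B)`, and its cokernel is the quotient of `C(X)` by
  -- the small chains. Hence `C(X)/C(A)` has Euler characteristic `b - c`.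
  let κ := iB ≫ π
  have w : j ≫ κ = 0 := by
    ext n x
    refine (hπ n _).2 ?_
    have h1 : (iB.f n).hom ((j.f n).hom x) ∈ chainsIn (A ∩ B) n := by
      rw [hji, ← range_chainsMap_incl]
      exact ⟨x, rfl⟩
    rw [← chainsIn_inf] at h1
    exact h1.1
  have hex : (ShortComplex.mk j κ w).Exact := by
    rw [HomologicalComplex.exact_iff_degreewise_exact]
    intro n
    rw [ShortComplex.moduleCat_exact_iff]
    intro x hx
    have h1 : (iB.f n).hom x ∈ chainsIn A n := (hπ n _).1 hx
    have h2 : (iB.f n).hom x ∈ chainsIn B n := by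
      rw [← range_chainsMap_incl]
      exact ⟨x, rfl⟩
    have h3 := Submodule.mem_inf.2 ⟨h1, h2⟩
    rw [chainsIn_inf, ← range_chainsMap_incl] at h3
    obtain ⟨z, hz⟩ := h3
    refine ⟨z, chainsMap_injective (f := incl B) Subtype.val_injective ?_⟩
    exact (hji n z).trans hz
  have hS' : (ShortComplex.mk κ (cokernel.π κ) (cokernel.condition κ)).Exact :=
    ShortComplex.exact_of_g_is_cokernel _ (cokernelIsCokernel κ)
  have hP := hasEuler_of_kernel_of_cokernel hex hc hb
    (subsingleton_homology_of_ker_eq hA hB hAB (π ≫ cokernel.π κ) (fun n => ?_) fun n => ?_)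
  · exact ChainComplex.HasEuler.middle hS ha hP
  · have : Epi (π ≫ cokernel.π κ) := epi_comp _ _
    exact (ModuleCat.epi_iff_surjective _).1
      (inferInstanceAs (Epi ((π ≫ cokernel.π κ).f n)))
  · ext x
    have h1 := SetLike.ext_iff.1
      ((HomologicalComplex.exact_iff_degreewise_exact _).1 hS' n).moduleCat_range_eq_ker
        ((π.f n).hom x)
    refine h1.symm.trans ?_
    rw [← chainsIn_sup, Submodule.mem_sup]
    constructor
    · rintro ⟨y, hy⟩
      have hy' : (π.f n).hom ((iB.f n).hom y) = (π.f n).hom x := hy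
      refine ⟨x - (iB.f n).hom y, ?_, (iB.f n).hom y, ?_, sub_add_cancel _ _⟩
      · rw [← hπ, map_sub, hy', sub_self]
      · rw [← range_chainsMap_incl]
        exact ⟨y, rfl⟩
    · rintro ⟨y, hy, z, hz, rfl⟩
      rw [← range_chainsMap_incl] at hz
      obtain ⟨z, rfl⟩ := hz
      refine ⟨z, ?_⟩
      change (π.f n).hom ((iB.f n).hom z) = _
      rw [map_add, (hπ n y).2 hy, zero_add]

end MayerVietoris

end SingularChains

/-- The rational homology is finite-dimensional and bounded, with Euler characteristic `e`. -/
def HasEulerChar (X : Type) [TopologicalSpace X] (e : ℤ) : Prop :=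
  (SingularChains.chainsQ (TopCat.of X)).HasEuler e

/-! ### Euler characteristics of spaces -/

namespace HasEulerChar

open CategoryTheory Limits AlgebraicTopology SingularChains

variable {X Y : Type} [TopologicalSpace X] [TopologicalSpace Y]

lemma of_homotopyEquiv {e : ℤ} (h : HasEulerChar X e) (i : ContinuousMap.HomotopyEquiv X Y) :
    HasEulerChar Y e := by
  obtain ⟨H₁⟩ := i.left_inv
  obtain ⟨H₂⟩ := i.right_inv
  have h₁ : TopCat.Homotopy (TopCat.ofHom i.toFun ≫ TopCat.ofHom i.invFun) (𝟙 (TopCat.of X)) := H₁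
  have h₂ : TopCat.Homotopy (TopCat.ofHom i.invFun ≫ TopCat.ofHom i.toFun) (𝟙 (TopCat.of Y)) := H₂
  refine ChainComplex.HasEuler.of_iso h fun k =>
    { hom := HomologicalComplex.homologyMap (chainsMap (TopCat.ofHom i.toFun)) k
      inv := HomologicalComplex.homologyMap (chainsMap (TopCat.ofHom i.invFun)) k
      hom_inv_id := ?_
      inv_hom_id := ?_ }
  · have := h₁.congr_homologyMap_singularChainComplexFunctor (ModuleCat.of ℚ ℚ) k
    rw [Functor.map_comp, HomologicalComplex.homologyMap_comp, CategoryTheory.Functor.map_id,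
      HomologicalComplex.homologyMap_id] at this
    exact this
  · have := h₂.congr_homologyMap_singularChainComplexFunctor (ModuleCat.of ℚ ℚ) k
    rw [Functor.map_comp, HomologicalComplex.homologyMap_comp, CategoryTheory.Functor.map_id,
      HomologicalComplex.homologyMap_id] at this
    exact this

lemma of_homeomorph {e : ℤ} (h : HasEulerChar X e) (i : X ≃ₜ Y) : HasEulerChar Y e :=
  h.of_homotopyEquiv i.toHomotopyEquiv

lemma of_isEmpty [IsEmpty X] : HasEulerChar X 0 := by
  refine ChainComplex.hasEuler_zero fun k => ?_
  rw [← ModuleCat.isZero_iff_subsingleton]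
  refine HomologicalComplex.ExactAt.isZero_homology (ShortComplex.exact_of_isZero_X₂ _ ?_)
  change IsZero ((chainsQ (TopCat.of X)).X k)
  rw [ModuleCat.isZero_iff_subsingleton]
  have : IsEmpty (Simp k X) := ⟨fun σ => IsEmpty.false (σ (Classical.arbitrary _))⟩
  exact (sing X k).repr.injective.subsingleton

lemma unit : HasEulerChar Unit 1 := by
  have hs : ∀ k, 1 ≤ k → Subsingleton ((chainsQ (TopCat.of Unit)).homology k) := fun k hk => by
    rw [← ModuleCat.isZero_iff_subsingleton]
    exact isZero_singularHomologyFunctor_of_totallyDisconnectedSpace (ModuleCat.{0} ℚ) k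
      (ModuleCat.of ℚ ℚ) (TopCat.of Unit) (by omega)
  have : Unique (TopCat.of Unit) := inferInstanceAs (Unique Unit)
  have i : (chainsQ (TopCat.of Unit)).homology 0 ≅ ModuleCat.of ℚ ℚ :=
    singularHomologyFunctorZeroOfTotallyDisconnectedSpace (ModuleCat.{0} ℚ)
      (ModuleCat.of ℚ ℚ) (TopCat.of Unit) ≪≫ coproductUniqueIso _
  refine ⟨fun k => ?_, ⟨1, hs⟩, ?_⟩
  · rcases Nat.eq_zero_or_pos k with rfl | hk
    · exact Module.Finite.equiv i.toLinearEquiv.symm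
    · have := hs k hk
      infer_instance
  · rw [ChainComplex.homologyEulerChar_eq_sum_range _ 1 hs, Finset.sum_range_one,
      i.toLinearEquiv.finrank_eq]
    simp

lemma of_contractibleSpace [ContractibleSpace X] : HasEulerChar X 1 := by
  obtain ⟨i⟩ := ContractibleSpace.hequiv_unit X
  exact unit.of_homotopyEquiv i.symm

end HasEulerChar

/-- The part in `U` of a set that contains `U` is homeomorphic to `U`. -/
def homeomorphPreimageVal {X : Type} [TopologicalSpace X] {U V : Set X} (h : U ⊆ V) :
    ↥((Subtype.val : V → X) ⁻¹' U) ≃ₜ U where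
  toFun x := ⟨x.1.1, x.2⟩
  invFun x := ⟨⟨x.1, h x.2⟩, x.2⟩
  left_inv _ := rfl
  right_inv _ := rfl
  continuous_toFun := by fun_prop
  continuous_invFun := by fun_prop

lemma HasEulerChar.union {X : Type} [TopologicalSpace X] {A B : Set X} (hA : IsOpen A)
    (hB : IsOpen B) {a b c : ℤ} (ha : HasEulerChar A a) (hb : HasEulerChar B b)
    (hc : HasEulerChar ↥(A ∩ B) c) : HasEulerChar ↥(A ∪ B) (a + b - c) := by
  rw [add_sub_assoc]
  refine SingularChains.hasEuler_of_cover (X := ↥(A ∪ B))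
    (A := Subtype.val ⁻¹' A) (B := Subtype.val ⁻¹' B) (hA.preimage continuous_subtype_val)
    (hB.preimage continuous_subtype_val) ?_
    (ha.of_homeomorph (homeomorphPreimageVal Set.subset_union_left).symm)
    (hb.of_homeomorph (homeomorphPreimageVal Set.subset_union_right).symm)
    (hc.of_homeomorph (homeomorphPreimageVal
      (Set.inter_subset_left.trans Set.subset_union_left)).symm)
  ext x
  exact iff_of_true x.2 trivial

/-! ### Products of discs and punctured planes -/

section Tori

open Complex

variable {ι : Type} [DecidableEq ι]

lemma pi_update_union {C : ι → Set ℂ} (i : ι) {U V : Set ℂ} :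
    Set.univ.pi (Function.update C i U) ∪ Set.univ.pi (Function.update C i V) =
      Set.univ.pi (Function.update C i (U ∪ V)) := by
  ext x
  simp only [Set.mem_union, Set.mem_univ_pi, Function.forall_update_iff C (fun j s => x j ∈ s)]
  tauto

lemma pi_update_inter {C : ι → Set ℂ} (i : ι) {U V : Set ℂ} :
    Set.univ.pi (Function.update C i U) ∩ Set.univ.pi (Function.update C i V) =
      Set.univ.pi (Function.update C i (U ∩ V)) := by
  ext x
  simp only [Set.mem_inter_iff, Set.mem_univ_pi, Function.forall_update_iff C (fun j s => x j ∈ s)]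
  tauto

/-- The Euler characteristic of a product of open star-shaped sets and punctured planes. -/
lemma hasEulerChar_pi [Fintype ι] (T : Finset ι) (C : ι → Set ℂ) (hT : ∀ i ∈ T, C i = {0}ᶜ)
    (hC : ∀ i ∉ T, IsOpen (C i) ∧ ∃ c ∈ C i, StarConvex ℝ c (C i)) :
    HasEulerChar ↥(Set.univ.pi C) (if T = ∅ then 1 else 0) := by
  have hopen : ∀ (T : Finset ι) (C : ι → Set ℂ), (∀ i ∈ T, C i = {0}ᶜ) →
      (∀ i ∉ T, IsOpen (C i) ∧ ∃ c ∈ C i, StarConvex ℝ c (C i)) → IsOpen (Set.univ.pi C) := by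
    intro T C hT hC
    refine isOpen_set_pi Set.finite_univ fun i _ => ?_
    by_cases hi : i ∈ T
    · rw [hT i hi]; exact isOpen_compl_singleton
    · exact (hC i hi).1
  induction T using Finset.induction_on generalizing C with
  | empty =>
    choose hO c hc hs using fun i => hC i (Finset.notMem_empty i)
    have hstar : StarConvex ℝ c (Set.univ.pi C) := fun y hy a b ha hb hab i _ =>
      hs i (hy i trivial) ha hb hab
    have := hstar.contractibleSpace ⟨c, fun i _ => hc i⟩
    simpa using HasEulerChar.of_contractibleSpace
  | insert i T hi ih =>
    rw [if_neg (Finset.insert_ne_empty i T)]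
    -- Replacing the punctured factor `i` by an open star-shaped `U` leaves only the punctured
    -- factors in `T`, so the inductive hypothesis applies to each piece.
    have hstep : ∀ U : Set ℂ, IsOpen U → (∃ c ∈ U, StarConvex ℝ c U) →
        (∀ k ∈ T, Function.update C i U k = {0}ᶜ) ∧ ∀ k ∉ T, IsOpen (Function.update C i U k) ∧
          ∃ c ∈ Function.update C i U k, StarConvex ℝ c (Function.update C i U k) := by
      intro U hU hU'
      refine ⟨fun k hk => ?_, fun k hk => ?_⟩
      · rw [Function.update_of_ne (by rintro rfl; exact hi hk)]
        exact hT k (Finset.mem_insert_of_mem hk)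
      · rcases eq_or_ne k i with rfl | hki
        · rw [Function.update_self]; exact ⟨hU, hU'⟩
        · rw [Function.update_of_ne hki]
          exact hC k (by simp [hki, hk])
    set e : ℤ := if T = ∅ then 1 else 0
    have hpiece : ∀ U : Set ℂ, IsOpen U → (∃ c ∈ U, StarConvex ℝ c U) →
        IsOpen (Set.univ.pi (Function.update C i U)) ∧
          HasEulerChar ↥(Set.univ.pi (Function.update C i U)) e := fun U hU hU' =>
      ⟨hopen T _ (hstep U hU hU').1 (hstep U hU hU').2,
        ih _ (hstep U hU hU').1 (hstep U hU hU').2⟩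
    -- The punctured plane is the union of two opposite slit planes, which meet in two disjoint half
    -- planes. With `e` for each piece the total is `e + e - (e + e) = 0`.
    obtain ⟨o₁, e₁⟩ := hpiece slitPlane isOpen_slitPlane ⟨1, by simp, starConvex_one_slitPlane⟩
    obtain ⟨o₂, e₂⟩ := hpiece (-slitPlane) isOpen_slitPlane.neg ⟨-1, by simp, by
      simpa using starConvex_one_slitPlane.neg⟩
    obtain ⟨o₃, e₃⟩ := hpiece {z | 0 < z.im} (isOpen_lt continuous_const continuous_im)
      ⟨I, by simp, (convex_halfSpace_im_gt 0).starConvex (by simp)⟩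
    obtain ⟨o₄, e₄⟩ := hpiece {z | z.im < 0} (isOpen_lt continuous_im continuous_const)
      ⟨-I, by simp, (convex_halfSpace_im_lt 0).starConvex (by simp)⟩
    have h₃₄ := e₃.union (c := 0) o₃ o₄ e₄ (by
      have : IsEmpty ↥(Set.univ.pi (Function.update C i {z | 0 < z.im}) ∩
          Set.univ.pi (Function.update C i {z | z.im < 0})) := by
        rw [pi_update_inter, Set.isEmpty_coe_sort, Set.eq_empty_iff_forall_notMem]
        intro x hx
        have := hx i trivial
        rw [Function.update_self] at this
        exact lt_asymm (show 0 < (x i).im from this.1) (show (x i).im < 0 from this.2)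
      exact HasEulerChar.of_isEmpty)
    have h₁₂ := e₁.union (c := e + e - 0) o₁ o₂ e₂ (by
      rw [pi_update_union] at h₃₄
      rw [pi_update_inter]
      have hset : slitPlane ∩ -slitPlane = {z : ℂ | 0 < z.im} ∪ {z | z.im < 0} := by
        ext z
        simp only [Set.mem_inter_iff, Set.mem_neg, mem_slitPlane_iff, neg_re, neg_im,
          Set.mem_union, Set.mem_ofPred_eq]
        grind
      rwa [hset])
    rw [pi_update_union] at h₁₂
    have : Function.update C i (slitPlane ∪ -slitPlane) = C := by
      refine Function.update_eq_iff.2 ⟨?_, fun _ _ => rfl⟩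
      rw [hT i (Finset.mem_insert_self _ _)]
      ext z
      simp only [Set.mem_union, Set.mem_neg, mem_slitPlane_iff, neg_re, neg_im,
        Set.mem_compl_iff, Set.mem_singleton_iff, Complex.ext_iff, zero_re, zero_im]
      grind
    rw [this] at h₁₂
    simpa using h₁₂

end Tori

lemma prod_zpow_eq_zpow_sum {ι G : Type*} [CommGroup G] (s : Finset ι) (f : ι → ℤ) (a : G) :
    ∏ i ∈ s, a ^ f i = a ^ ∑ i ∈ s, f i := by
  classical
  induction s using Finset.induction_on with
  | empty => simp
  | insert i s hi ih => rw [Finset.prod_insert hi, Finset.sum_insert hi, ih, zpow_add]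

/-! ### Affine charts in Cox's homogeneous coordinates -/

namespace ToricCY3

variable (Y : ToricCY3)

/-- The `j`-th barycentric coordinate of a lattice point with respect to the triangle `v`. -/
def coord (v : Y.Vertex) (j : Fin 3) (r : ℤ × ℤ) : ℤ :=
  latticeDet (Y.corner v 0) (Y.corner v 1) (Y.corner v 2) *
    latticeDet r (Y.corner v (j + 1)) (Y.corner v (j + 2))

variable {Y} {v : Y.Vertex}

lemma latticeDet_mul_self : latticeDet (Y.corner v 0) (Y.corner v 1) (Y.corner v 2) *
    latticeDet (Y.corner v 0) (Y.corner v 1) (Y.corner v 2) = 1 := by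
  rcases Y.unimodular v with h | h <;> rw [h] <;> norm_num

lemma coord_corner (i j : Fin 3) : Y.coord v j (Y.corner v i) = if i = j then 1 else 0 := by
  have := latticeDet_mul_self (v := v)
  fin_cases i <;> fin_cases j <;> simp [coord, latticeDet] at this ⊢ <;> linarith

lemma sum_coord (r : ℤ × ℤ) : ∑ j, Y.coord v j r = 1 := by
  have := latticeDet_mul_self (v := v)
  simp [coord, latticeDet, Fin.sum_univ_three] at this ⊢
  linarith

lemma sum_coord_mul_fst (r : ℤ × ℤ) : ∑ j, Y.coord v j r * (Y.corner v j).1 = r.1 := by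
  have := latticeDet_mul_self (v := v)
  simp [coord, latticeDet, Fin.sum_univ_three] at this ⊢
  linear_combination r.1 * this

lemma sum_coord_mul_snd (r : ℤ × ℤ) : ∑ j, Y.coord v j r * (Y.corner v j).2 = r.2 := by
  have := latticeDet_mul_self (v := v)
  simp [coord, latticeDet, Fin.sum_univ_three] at this ⊢
  linear_combination r.2 * this

lemma exists_coord_eq (v : Y.Vertex) (j : Fin 3) :
    ∃ a b c : ℤ, ∀ r, Y.coord v j r = a * r.1 + b * r.2 + c := by
  refine ⟨Y.coord v j (1, 0) - Y.coord v j (0, 0), Y.coord v j (0, 1) - Y.coord v j (0, 0),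
    Y.coord v j (0, 0), fun r => ?_⟩
  simp only [coord, latticeDet]
  ring

lemma corner_injective : Function.Injective (Y.corner v) := by
  intro i j h
  have := coord_corner (v := v) i j
  rw [h, coord_corner, if_pos rfl] at this
  by_contra hij
  simp [hij] at this

/-- The ray through a corner. -/
def cornerRay (v : Y.Vertex) (j : Fin 3) : Y.rays :=
  ⟨Y.corner v j, Finset.mem_image.2 ⟨(v, j), Finset.mem_univ _, rfl⟩⟩

/-- The part of the toric variety where only the coordinates of the rays in `S` may vanish. -/
def chart (Y : ToricCY3) (S : Set (ℤ × ℤ)) : Set Y.Space :=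
  {q | Quotient.liftOn q (fun x : Y.coxOpen => ∀ p : Y.rays, (p : ℤ × ℤ) ∉ S → x.1 p ≠ 0) (by
    rintro x y ⟨g, -, h⟩
    simp [h])}

/-- The point with given homogeneous coordinates. -/
def point (Y : ToricCY3) (x : Y.coxOpen) : Y.Space := Quotient.mk _ x

lemma isQuotientMap_point : Topology.IsQuotientMap Y.point := isQuotientMap_quot_mk

lemma point_mem_chart {x : Y.coxOpen} {S : Set (ℤ × ℤ)} :
    Y.point x ∈ Y.chart S ↔ ∀ p : Y.rays, (p : ℤ × ℤ) ∉ S → x.1 p ≠ 0 := Iff.rfl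

lemma isOpen_chart (S : Set (ℤ × ℤ)) : IsOpen (Y.chart S) := by
  rw [← isQuotientMap_point.isOpen_preimage]
  have : Y.point ⁻¹' Y.chart S =
      ⋂ p : Y.rays, ⋂ _ : (p : ℤ × ℤ) ∉ S, {x : Y.coxOpen | x.1 p ≠ 0} := by
    ext x
    simp only [Set.mem_preimage, point_mem_chart, Set.mem_iInter]
    rfl
  rw [this]
  refine isOpen_iInter_of_finite fun p => isOpen_iInter_of_finite fun _ => ?_
  exact isOpen_ne_fun ((continuous_apply p).comp continuous_subtype_val) continuous_const

lemma chart_inter (S T : Set (ℤ × ℤ)) : Y.chart S ∩ Y.chart T = Y.chart (S ∩ T) := by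
  ext q
  obtain ⟨x, rfl⟩ := isQuotientMap_point.surjective q
  simp only [Set.mem_inter_iff, point_mem_chart, not_and_or]
  grind

lemma iUnion_chart : ⋃ v, Y.chart (Set.range (Y.corner v)) = Set.univ := by
  rw [Set.eq_univ_iff_forall]
  intro q
  obtain ⟨x, rfl⟩ := isQuotientMap_point.surjective q
  obtain ⟨v, hv⟩ := x.2
  exact Set.mem_iUnion.2 ⟨v, point_mem_chart.2 fun p hp h => hp (hv p h)⟩

/-- The affine coordinates at the fixed point `v`, in terms of homogeneous coordinates. -/
noncomputable def affineCoord (v : Y.Vertex) (x : Y.rays → ℂ) (j : Fin 3) : ℂ :=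
  ∏ p, x p ^ Y.coord v j p

/-- The exponents are an integral affine function of the ray, and the relations that define
`coxGroup` kill every monomial of this kind. -/
lemma affineCoord_smul {g : Y.rays → ℂˣ} (hg : g ∈ Y.coxGroup) (x : Y.rays → ℂ) (j : Fin 3) :
    affineCoord v (fun p => (g p : ℂ) * x p) j = affineCoord v x j := by
  obtain ⟨h₁, h₂, h₃⟩ := hg
  obtain ⟨a, b, c, h⟩ := exists_coord_eq v j
  have h1 : ∏ p : Y.rays, g p ^ Y.coord v j p = 1 := by
    simp only [h, zpow_add, mul_comm a, mul_comm b, zpow_mul, Finset.prod_mul_distrib,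
      Finset.prod_zpow, h₁, h₂, h₃, one_zpow, mul_one]
  have h2 : ∏ p : Y.rays, ((g p : ℂ)) ^ Y.coord v j p = 1 := by
    simpa using congrArg (Units.val : ℂˣ → ℂ) h1
  simp only [affineCoord, mul_zpow, Finset.prod_mul_distrib, h2, one_mul]

/-- The affine coordinates at the fixed point `v`. -/
noncomputable def chartCoord (v : Y.Vertex) (q : Y.Space) : Fin 3 → ℂ :=
  Quotient.liftOn q (fun x : Y.coxOpen => affineCoord v x.1) (by
    rintro x y ⟨g, hg, h⟩
    rw [show y.1 = fun p => (g p : ℂ) * x.1 p from funext h]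
    exact (funext fun j => affineCoord_smul hg x.1 j).symm)

lemma chartCoord_point (x : Y.coxOpen) : chartCoord v (Y.point x) = affineCoord v x.1 := rfl

lemma continuousOn_chartCoord {S : Set (ℤ × ℤ)} (hS : S ⊆ Set.range (Y.corner v)) :
    ContinuousOn (chartCoord v) (Y.chart S) := by
  rw [isQuotientMap_point.continuousOn_isOpen_iff (isOpen_chart S)]
  refine continuousOn_pi.2 fun j => ?_
  change ContinuousOn (fun x : Y.coxOpen => ∏ p, x.1 p ^ Y.coord v j p) _
  refine continuousOn_finsetProd _ fun p _ => ?_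
  have hcont : Continuous fun x : Y.coxOpen => x.1 p :=
    (continuous_apply p).comp continuous_subtype_val
  by_cases hp : (p : ℤ × ℤ) ∈ Set.range (Y.corner v)
  · obtain ⟨i, hi⟩ := hp
    rw [← hi, coord_corner]
    split_ifs
    · simpa using hcont.continuousOn
    · simpa using continuousOn_const
  · refine ContinuousOn.zpow₀ hcont.continuousOn _ fun x hx => Or.inl ?_
    exact point_mem_chart.1 hx p fun h => hp (hS h)

/-- The homogeneous coordinates of the point with given affine coordinates. -/
noncomputable def homogenize (v : Y.Vertex) (y : Fin 3 → ℂ) (p : Y.rays) : ℂ :=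
  ∏ j, if cornerRay v j = p then y j else 1

lemma cornerRay_injective : Function.Injective (cornerRay v) := fun _ _ h =>
  corner_injective (v := v) (congrArg Subtype.val h)

lemma homogenize_cornerRay (y : Fin 3 → ℂ) (i : Fin 3) :
    homogenize v y (cornerRay v i) = y i := by
  simp only [homogenize, cornerRay_injective.eq_iff]
  simp

lemma homogenize_of_notMem (y : Fin 3 → ℂ) {p : Y.rays}
    (hp : (p : ℤ × ℤ) ∉ Set.range (Y.corner v)) : homogenize v y p = 1 := by
  refine Finset.prod_eq_one fun j _ => if_neg ?_
  rintro rfl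
  exact hp ⟨j, rfl⟩

lemma homogenize_mem (y : Fin 3 → ℂ) : homogenize v y ∈ Y.coxOpen := by
  refine ⟨v, fun p hp => ?_⟩
  by_contra h
  rw [homogenize_of_notMem y h] at hp
  exact one_ne_zero hp

lemma continuous_homogenize : Continuous (homogenize v) := by
  refine continuous_pi fun p => continuous_finsetProd _ fun j _ => ?_
  split_ifs <;> fun_prop

lemma affineCoord_homogenize (y : Fin 3 → ℂ) : affineCoord v (homogenize v y) = y := by
  ext j
  rw [affineCoord, Finset.prod_eq_single (cornerRay v j)]
  · rw [homogenize_cornerRay]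
    simp [cornerRay, coord_corner]
  · intro p _ hp
    by_cases h : (p : ℤ × ℤ) ∈ Set.range (Y.corner v)
    · obtain ⟨i, hi⟩ := h
      obtain rfl : cornerRay v i = p := Subtype.ext hi
      have : i ≠ j := by rintro rfl; exact hp rfl
      simp [cornerRay, coord_corner, this]
    · rw [homogenize_of_notMem y h, one_zpow]
  · simp

/-- The element of the group that normalizes the homogeneous coordinates outside a triangle. -/
noncomputable def normalizer (v : Y.Vertex) (u : Y.rays → ℂˣ) (p : Y.rays) : ℂˣ :=
  (∏ r, u r ^ ∑ j, if cornerRay v j = p then Y.coord v j r else 0) * (u p)⁻¹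

/-- The hypothesis says that barycentric interpolation from the corners reproduces `ℓ`. Then each `u
r` occurs with exponent `ℓ r` from the corners and `-ℓ r` from the inverse. -/
lemma prod_normalizer_zpow (u : Y.rays → ℂˣ) (ℓ : ℤ × ℤ → ℤ)
    (hℓ : ∀ r, ∑ j, Y.coord v j r * ℓ (Y.corner v j) = ℓ r) :
    ∏ p, normalizer v u p ^ ℓ p = 1 := by
  have h : ∀ r : Y.rays, ∑ p : Y.rays, (∑ j, if cornerRay v j = p then Y.coord v j r else 0) * ℓ p
      = ℓ r := by
    intro r
    rw [← hℓ]
    simp only [Finset.sum_mul, ite_mul, zero_mul]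
    rw [Finset.sum_comm]
    refine Finset.sum_congr rfl fun j _ => ?_
    rw [Finset.sum_ite_eq, if_pos (Finset.mem_univ _)]
    rfl
  simp only [normalizer, mul_zpow, ← Finset.prod_zpow, ← zpow_mul, Finset.prod_mul_distrib]
  rw [Finset.prod_comm]
  simp only [prod_zpow_eq_zpow_sum, h]
  rw [← Finset.prod_mul_distrib]
  simp

lemma normalizer_mem (u : Y.rays → ℂˣ) : normalizer v u ∈ Y.coxGroup :=
  ⟨prod_normalizer_zpow u Prod.fst sum_coord_mul_fst,
    prod_normalizer_zpow u Prod.snd sum_coord_mul_snd, by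
      simpa using prod_normalizer_zpow (v := v) u (fun _ => 1) (by simpa using sum_coord)⟩

lemma point_homogenize {x : Y.coxOpen} (hx : Y.point x ∈ Y.chart (Set.range (Y.corner v))) :
    Y.point ⟨homogenize v (affineCoord v x.1), homogenize_mem _⟩ = Y.point x := by
  classical
  have hx' : ∀ p : Y.rays, (p : ℤ × ℤ) ∉ Set.range (Y.corner v) → x.1 p ≠ 0 := hx
  -- Normalizing by this `u` makes all coordinates outside the triangle equal to `1`, and multiplies
  -- each corner coordinate by exactly the factors missing from the affine coordinate.
  let u : Y.rays → ℂˣ := fun p =>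
    if h : (p : ℤ × ℤ) ∈ Set.range (Y.corner v) then 1 else Units.mk0 (x.1 p) (hx' p h)
  refine (Quotient.sound ?_).symm
  refine ⟨normalizer v u, normalizer_mem u, fun p => ?_⟩
  change homogenize v (affineCoord v x.1) p = _
  by_cases hp : (p : ℤ × ℤ) ∈ Set.range (Y.corner v)
  · obtain ⟨i, hi⟩ := hp
    obtain rfl : cornerRay v i = p := Subtype.ext hi
    have hu : u (cornerRay v i) = 1 := dif_pos ⟨i, rfl⟩
    rw [homogenize_cornerRay, normalizer, hu]
    simp only [cornerRay_injective.eq_iff, Finset.sum_ite_eq', Finset.mem_univ, if_true, inv_one,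
      mul_one, affineCoord, Units.coe_prod, Units.val_zpow_eq_zpow_val]
    rw [← Finset.prod_erase_mul _ _ (Finset.mem_univ (cornerRay v i)),
      ← Finset.prod_erase_mul _ (fun r => (u r : ℂ) ^ _) (Finset.mem_univ (cornerRay v i)), hu]
    congr 1
    · rw [Units.val_one, one_zpow, mul_one]
      refine Finset.prod_congr rfl fun r hr => ?_
      by_cases hr' : (r : ℤ × ℤ) ∈ Set.range (Y.corner v)
      · obtain ⟨k, hk⟩ := hr'
        have : k ≠ i := by
          rintro rfl
          exact Finset.ne_of_mem_erase hr (Subtype.ext hk.symm)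
        rw [← hk, coord_corner, if_neg this, zpow_zero, zpow_zero]
      · rw [show u r = Units.mk0 (x.1 r) (hx' r hr') from dif_neg hr', Units.val_mk0]
    · simp [cornerRay, coord_corner]
  · have hne : ∀ j, cornerRay v j ≠ p := by rintro j rfl; exact hp ⟨j, rfl⟩
    have hu : u p = Units.mk0 (x.1 p) (hx' p hp) := dif_neg hp
    rw [homogenize_of_notMem _ hp, normalizer, hu]
    simp [hne, hx' p hp]

end ToricCY3

/-! ### The Euler characteristic counts the triangles -/

namespace ToricCY3

variable {Y : ToricCY3} {v : Y.Vertex}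

/-- The locus in affine space that corresponds to a chart. -/
def chartModel (v : Y.Vertex) (S : Set (ℤ × ℤ)) : Set (Fin 3 → ℂ) :=
  {y | ∀ j, Y.corner v j ∉ S → y j ≠ 0}

lemma point_homogenize_mem {S : Set (ℤ × ℤ)} {y : Fin 3 → ℂ} (hy : y ∈ chartModel v S) :
    Y.point ⟨homogenize v y, homogenize_mem y⟩ ∈ Y.chart S := by
  refine point_mem_chart.2 fun p hp => ?_
  change homogenize v y p ≠ 0
  by_cases h : (p : ℤ × ℤ) ∈ Set.range (Y.corner v)
  · obtain ⟨i, hi⟩ := h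
    obtain rfl : cornerRay v i = p := Subtype.ext hi
    rw [homogenize_cornerRay]
    exact hy i hp
  · rw [homogenize_of_notMem y h]
    exact one_ne_zero

lemma chartCoord_mem {S : Set (ℤ × ℤ)} (hS : S ⊆ Set.range (Y.corner v)) {q : Y.Space}
    (hq : q ∈ Y.chart S) : chartCoord v q ∈ chartModel v S := by
  obtain ⟨x, rfl⟩ := isQuotientMap_point.surjective q
  intro j hj
  rw [chartCoord_point, affineCoord, Finset.prod_ne_zero_iff]
  intro p _ h
  have h0 : x.1 p = 0 := by
    by_contra h0
    exact zpow_ne_zero _ h0 h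
  have hp : (p : ℤ × ℤ) ∈ S := by
    by_contra hp
    exact point_mem_chart.1 hq p hp h0
  obtain ⟨i, hi⟩ := hS hp
  have hij : i ≠ j := by
    rintro rfl
    exact hj (hi ▸ hp)
  rw [← hi, coord_corner, if_neg hij, zpow_zero] at h
  exact one_ne_zero h

/-- A chart is homeomorphic to a product of affine lines and punctured affine lines. -/
noncomputable def chartHomeomorph (v : Y.Vertex) {S : Set (ℤ × ℤ)}
    (hS : S ⊆ Set.range (Y.corner v)) : Y.chart S ≃ₜ chartModel v S where
  toFun q := ⟨chartCoord v q, chartCoord_mem hS q.2⟩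
  invFun y := ⟨Y.point ⟨homogenize v y, homogenize_mem y.1⟩, point_homogenize_mem y.2⟩
  left_inv := by
    rintro ⟨q, hq⟩
    obtain ⟨x, rfl⟩ := isQuotientMap_point.surjective q
    exact Subtype.ext (point_homogenize (point_mem_chart.2 fun p hp =>
      point_mem_chart.1 hq p fun h => hp (hS h)))
  right_inv := by
    rintro ⟨y, hy⟩
    exact Subtype.ext (affineCoord_homogenize y)
  continuous_toFun := by
    refine Continuous.subtype_mk ?_ _
    exact continuousOn_iff_continuous_domRestrict.1 (continuousOn_chartCoord hS)
  continuous_invFun := by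
    refine Continuous.subtype_mk ?_ _
    exact isQuotientMap_point.continuous.comp
      ((continuous_homogenize.comp continuous_subtype_val).subtype_mk _)

lemma chartModel_eq_pi (v : Y.Vertex) (S : Set (ℤ × ℤ)) [DecidablePred (· ∈ S)] :
    chartModel v S =
      Set.univ.pi fun j => if Y.corner v j ∈ S then (Set.univ : Set ℂ) else {0}ᶜ := by
  ext y
  simp only [chartModel, Set.mem_univ_pi]
  refine forall_congr' fun j => ?_
  split_ifs with h <;> simp [h]

lemma hasEulerChar_chart (v : Y.Vertex) {S : Set (ℤ × ℤ)} [DecidablePred (· ∈ S)]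
    (hS : S ⊆ Set.range (Y.corner v)) :
    HasEulerChar (Y.chart S)
      (if (Finset.univ.filter fun j => Y.corner v j ∉ S) = ∅ then 1 else 0) := by
  refine HasEulerChar.of_homeomorph ?_ (chartHomeomorph v hS).symm
  rw [chartModel_eq_pi]
  refine hasEulerChar_pi _ _ (fun i hi => ?_) fun i hi => ?_
  · rw [if_neg (by simpa using hi)]
  · rw [if_pos (by simpa using hi)]
    exact ⟨isOpen_univ, 0, trivial, starConvex_univ 0⟩

lemma hasEulerChar_chart_range (v : Y.Vertex) :
    HasEulerChar (Y.chart (Set.range (Y.corner v))) 1 := by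
  classical
  have := hasEulerChar_chart v (subset_refl (Set.range (Y.corner v)))
  rwa [if_pos (by simp)] at this

lemma hasEulerChar_chart_of_ssubset {S : Set (ℤ × ℤ)} (hS : S ⊂ Set.range (Y.corner v)) :
    HasEulerChar (Y.chart S) 0 := by
  classical
  have := hasEulerChar_chart v hS.subset
  rwa [if_neg] at this
  intro h
  refine hS.not_subset ?_
  rintro _ ⟨j, rfl⟩
  by_contra hj
  exact Finset.notMem_empty j (h ▸ Finset.mem_filter.2 ⟨Finset.mem_univ j, hj⟩)

/-- The union of the charts of a list of cones. -/
def chartUnion (Y : ToricCY3) (L : List (Set (ℤ × ℤ))) : Set Y.Space := ⋃ S ∈ L, Y.chart S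

lemma chartUnion_cons (S : Set (ℤ × ℤ)) (L : List (Set (ℤ × ℤ))) :
    Y.chartUnion (S :: L) = Y.chart S ∪ Y.chartUnion L := by
  simp [chartUnion, Set.iUnion_or, Set.iUnion_union_distrib]

lemma chart_inter_chartUnion (S : Set (ℤ × ℤ)) (L : List (Set (ℤ × ℤ))) :
    Y.chart S ∩ Y.chartUnion L = Y.chartUnion (L.map (S ∩ ·)) := by
  simp [chartUnion, Set.inter_iUnion, chart_inter]

lemma isOpen_chartUnion (L : List (Set (ℤ × ℤ))) : IsOpen (Y.chartUnion L) :=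
  isOpen_biUnion fun S _ => isOpen_chart S

lemma hasEulerChar_nil : HasEulerChar (Y.chartUnion []) 0 := by
  have : IsEmpty (Y.chartUnion []) := by simp [chartUnion]
  exact HasEulerChar.of_isEmpty

/-- Intersecting with one more chart keeps all the corner sets proper. Induction is on the length of
the list because the intersection is a union of a different list of the same length. -/
lemma hasEulerChar_chartUnion_of_ssubset (n : ℕ) (L : List (Set (ℤ × ℤ))) (hn : L.length = n)
    (hL : ∀ S ∈ L, ∃ v, S ⊂ Set.range (Y.corner v)) : HasEulerChar (Y.chartUnion L) 0 := by
  induction n generalizing L with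
  | zero =>
    obtain rfl := List.length_eq_zero_iff.1 hn
    exact hasEulerChar_nil
  | succ n ih =>
    obtain ⟨S, L, rfl⟩ := List.exists_cons_of_length_eq_add_one hn
    obtain ⟨v, hv⟩ := hL S List.mem_cons_self
    rw [chartUnion_cons]
    refine (hasEulerChar_chart_of_ssubset hv).union (c := 0) (isOpen_chart S)
      (isOpen_chartUnion L) (ih L (by simpa using hn) fun T hT =>
        hL T (List.mem_cons_of_mem S hT)) ?_
    rw [chart_inter_chartUnion]
    refine ih _ (by simpa using hn) fun T hT => ?_
    obtain ⟨T', -, rfl⟩ := List.mem_map.1 hT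
    exact ⟨v, Set.inter_subset_left.trans_ssubset hv⟩

lemma range_corner_inter_ssubset {v w : Y.Vertex} (h : v ≠ w) :
    Set.range (Y.corner v) ∩ Set.range (Y.corner w) ⊂ Set.range (Y.corner v) := by
  refine Set.inter_subset_left.ssubset_of_ne fun heq => h (Y.distinct v w ?_)
  refine Set.eq_of_subset_of_ncard_le (Set.inter_eq_left.1 heq) ?_ (Set.finite_range _)
  rw [Set.ncard_range_of_injective corner_injective, Set.ncard_range_of_injective corner_injective]

/-- A new triangle contributes `ℂ³`, with Euler characteristic `1`, and meets the union of the
earlier charts in charts of proper subsets of its corners, with total Euler characteristic `0`. -/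
lemma hasEulerChar_chartUnion (L : List Y.Vertex) (hL : L.Nodup) :
    HasEulerChar (Y.chartUnion (L.map fun v => Set.range (Y.corner v))) L.length := by
  induction L with
  | nil => exact hasEulerChar_nil
  | cons v L ih =>
    obtain ⟨hv, hL⟩ := List.nodup_cons.1 hL
    rw [List.map_cons, chartUnion_cons]
    have := (hasEulerChar_chart_range v).union (c := 0) (isOpen_chart _) (isOpen_chartUnion _)
      (ih hL) (by
        rw [chart_inter_chartUnion]
        refine hasEulerChar_chartUnion_of_ssubset _ _ rfl fun T hT => ?_
        rw [List.map_map] at hT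
        obtain ⟨w, hw, rfl⟩ := List.mem_map.1 hT
        exact ⟨v, range_corner_inter_ssubset (by rintro rfl; exact hv hw)⟩)
    convert this using 1
    push_cast [List.length_cons]
    ring

/-- The Euler characteristic of a toric Calabi-Yau 3-fold is the number of its fixed points. -/
theorem hasEulerChar_space (Y : ToricCY3) : HasEulerChar Y.Space Y.numVertices := by
  have h := hasEulerChar_chartUnion (List.finRange Y.numVertices) (List.nodup_finRange _)
  have hu : Y.chartUnion ((List.finRange Y.numVertices).map fun v => Set.range (Y.corner v)) =
      Set.univ := by
    rw [← iUnion_chart]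
    simp [chartUnion]
  rw [hu, List.length_finRange] at h
  exact h.of_homeomorph (Homeomorph.Set.univ _)

theorem hasFiniteHomology (Y : ToricCY3) : Y.HasFiniteHomology :=
  ⟨Y.hasEulerChar_space.1, Y.hasEulerChar_space.2.1⟩

theorem eulerCharacteristic_eq (Y : ToricCY3) : Y.eulerCharacteristic = Y.numVertices :=
  Y.hasEulerChar_space.2.2

end ToricCY3

/-! ### Theta functions and the three-term relation -/

namespace JacobiTheta

open Complex Real

/-- The general term of the theta series with characteristic `a`, nome `exp (πi τ)`. -/
noncomputable def term (a τ z : ℂ) (n : ℤ) : ℂ :=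
  cexp (π * I * τ * (n + a) ^ 2 + 2 * π * I * (n + a) * z)

lemma term_eq (a τ z : ℂ) (n : ℤ) : term a τ z n =
    cexp (π * I * τ * a ^ 2 + 2 * π * I * a * z) * jacobiTheta₂_term n (z + a * τ) τ := by
  rw [term, jacobiTheta₂_term, ← Complex.exp_add]
  congr 1
  ring

lemma summable_term (a z : ℂ) {τ : ℂ} (hτ : 0 < τ.im) : Summable (term a τ z) := by
  simp only [funext (term_eq a τ z)]
  exact ((summable_jacobiTheta₂_term_iff _ _).2 hτ).mul_left _

lemma summable_norm_term (a z : ℂ) {τ : ℂ} (hτ : 0 < τ.im) : Summable fun n => ‖term a τ z n‖ :=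
  (summable_term a z hτ).norm

/-- The theta series with characteristic `a`. -/
noncomputable def theta (a τ z : ℂ) : ℂ := ∑' n, term a τ z n

lemma theta_eq (a τ z : ℂ) : theta a τ z =
    cexp (π * I * τ * a ^ 2 + 2 * π * I * a * z) * jacobiTheta₂ (z + a * τ) τ := by
  rw [theta, jacobiTheta₂, ← tsum_mul_left]
  exact tsum_congr (term_eq a τ z)

lemma theta1_term (τ z : ℂ) (n : ℤ) : (-1 : ℂ) ^ n *
    cexp (2 * (π : ℂ) * I * τ * (((n : ℂ) - 1 / 2) ^ 2 / 2)) *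
    cexp (2 * (π : ℂ) * I * z * ((n : ℂ) - 1 / 2)) =
    I * term (-1 / 2) τ (z + 1 / 2) n := by
  have h : (-1 : ℂ) ^ n = cexp (π * I * n) := by
    rw [mul_comm, Complex.exp_int_mul, Complex.exp_pi_mul_I]
  have hI : I * term (-1 / 2) τ (z + 1 / 2) n =
      cexp (π / 2 * I) * term (-1 / 2) τ (z + 1 / 2) n := by
    rw [Complex.exp_pi_div_two_mul_I]
  rw [hI, h, term, ← Complex.exp_add, ← Complex.exp_add, ← Complex.exp_add]
  congr 1
  ring

/-- The sign `(-1)^n` is absorbed into the shift of `z` by `1 / 2`, at the cost of a factor `i`,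
which combines with the prefactor to `-1`. -/
lemma theta1_eq (τ z : ℂ) : theta1 τ z = -theta (-1 / 2) τ (z + 1 / 2) := by
  rw [theta1, tsum_congr (theta1_term τ z), tsum_mul_left, ← mul_assoc, I_mul_I, neg_one_mul]
  rfl

lemma differentiable_theta1 {τ : ℂ} (hτ : 0 < τ.im) : Differentiable ℂ (theta1 τ) := by
  have : theta1 τ = fun z => -(cexp (π * I * τ * (-1 / 2) ^ 2 + 2 * π * I * (-1 / 2) *
      (z + 1 / 2)) * jacobiTheta₂ (z + 1 / 2 + -1 / 2 * τ) τ) := by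
    ext z
    rw [theta1_eq, theta_eq]
  rw [this]
  intro z
  have h := differentiableAt_jacobiTheta₂_fst (z + 1 / 2 + -1 / 2 * τ) hτ
  have h' : DifferentiableAt ℂ (fun z : ℂ => jacobiTheta₂ (z + 1 / 2 + -1 / 2 * τ) τ) z :=
    DifferentiableAt.comp (g := fun w => jacobiTheta₂ w τ) z h (by fun_prop)
  fun_prop

/-- The substitution `n ↦ 1 - n` negates `n - 1/2` and flips the sign `(-1)^n`. -/
lemma theta1_neg (τ z : ℂ) : theta1 τ (-z) = -theta1 τ z := by
  rw [theta1, theta1, ← mul_neg, ← tsum_neg, ← (Equiv.subLeft (1 : ℤ)).tsum_eq]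
  congr 1
  refine tsum_congr fun n => ?_
  have h : (-1 : ℂ) ^ (1 - n) = -(-1) ^ n := by
    rw [zpow_sub₀ (by norm_num), zpow_one, div_eq_mul_inv, ← inv_zpow]
    norm_num
  simp only [Equiv.subLeft_apply, h]
  push_cast
  rw [neg_mul, neg_mul]
  congr 2
  · congr 2
    ring
  · congr 1
    ring

/-- Pairs of integers, split according to the parity of their sum. -/
noncomputable def parityEquiv : (ℤ × ℤ) ⊕ (ℤ × ℤ) ≃ ℤ × ℤ :=
  Equiv.ofBijective
    (Sum.elim (fun p => (p.1 + p.2, p.1 - p.2)) fun p => (p.1 + p.2, p.1 - p.2 + 1)) (by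
      constructor
      · rintro (⟨a, b⟩ | ⟨a, b⟩) (⟨c, d⟩ | ⟨c, d⟩) h <;>
          simp only [Sum.elim_inl, Sum.elim_inr, Prod.mk.injEq] at h
        · congr 2 <;> omega
        · omega
        · omega
        · congr 2 <;> omega
      · rintro ⟨m, n⟩
        rcases Int.even_or_odd' (m + n) with ⟨k, hk | hk⟩
        · exact ⟨Sum.inl (k, m - k), Prod.ext (by simp) (by simp; omega)⟩
        · exact ⟨Sum.inr (k, m - k), Prod.ext (by simp) (by simp; omega)⟩)

/-- The product of two theta series as a double series, in terms of the sum and the difference of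
the indices. -/
lemma theta_mul_theta (x y : ℂ) {τ : ℂ} (hτ : 0 < τ.im) :
    theta (-1 / 2) τ (x + y) * theta (-1 / 2) τ (x - y) =
      theta (-1 / 2) (2 * τ) (2 * x) * theta 0 (2 * τ) (2 * y) +
        theta 0 (2 * τ) (2 * x) * theta (-1 / 2) (2 * τ) (2 * y) := by
  have hτ' : 0 < (2 * τ).im := by simpa using hτ
  have h₁ := summable_mul_of_summable_norm (summable_norm_term (-1 / 2) (x + y) hτ)
    (summable_norm_term (-1 / 2) (x - y) hτ)
  rw [theta, theta, theta, theta, theta, theta,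
    tsum_mul_tsum_of_summable_norm (summable_norm_term _ _ hτ) (summable_norm_term _ _ hτ),
    tsum_mul_tsum_of_summable_norm (summable_norm_term _ _ hτ') (summable_norm_term _ _ hτ'),
    tsum_mul_tsum_of_summable_norm (summable_norm_term _ _ hτ') (summable_norm_term _ _ hτ'),
    ← parityEquiv.tsum_eq]
  have h₂ := parityEquiv.summable_iff.2 h₁
  have h₃ := Summable.tsum_sum (h₂.comp_injective Sum.inl_injective)
    (h₂.comp_injective Sum.inr_injective)
  refine h₃.trans ?_
  congr 1
  -- For `(m, n) = (p + q, p - q)` one has `(m - 1/2)² + (n - 1/2)² = 2(p - 1/2)² + 2q²`; in the odd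
  -- case, with `n = p - q + 1`, the half moves from `p` to `q`. The factor `2` is absorbed by `2τ`.
  · refine tsum_congr fun p => ?_
    change term _ _ _ (p.1 + p.2) * term _ _ _ (p.1 - p.2) = _
    rw [term, term, term, term, ← Complex.exp_add, ← Complex.exp_add]
    congr 1
    push_cast
    ring
  · refine tsum_congr fun p => ?_
    change term _ _ _ (p.1 + p.2) * term _ _ _ (p.1 - p.2 + 1) = _
    rw [term, term, term, term, ← Complex.exp_add, ← Complex.exp_add]
    congr 1
    push_cast
    ring

lemma theta_zero_add_one (τ z : ℂ) : theta 0 τ (z + 1) = theta 0 τ z := by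
  refine tsum_congr fun n => ?_
  rw [term, term, mul_add (2 * π * I * (n + 0) : ℂ), ← add_assoc, Complex.exp_add]
  have : cexp (2 * π * I * (n + 0) * 1) = 1 := by
    rw [show (2 * π * I * (n + 0) * 1 : ℂ) = n * (2 * π * I) by ring,
      Complex.exp_int_mul_two_pi_mul_I]
  rw [this, mul_one]

lemma theta_neg_half_add_one (τ z : ℂ) : theta (-1 / 2) τ (z + 1) = -theta (-1 / 2) τ z := by
  rw [theta, theta, ← tsum_neg]
  refine tsum_congr fun n => ?_
  rw [term, term, mul_add (2 * π * I * (n + -1 / 2) : ℂ), ← add_assoc, Complex.exp_add]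
  have : cexp (2 * π * I * (n + -1 / 2) * 1) = -1 := by
    have h : (2 * π * I * (n + -1 / 2) * 1 : ℂ) = n * (2 * π * I) + -(π * I) := by ring
    rw [h, Complex.exp_add, Complex.exp_int_mul_two_pi_mul_I, Complex.exp_neg,
      Complex.exp_pi_mul_I]
    norm_num
  rw [this, mul_neg_one]

/-- The shift by `1 / 2` in `theta1` becomes a shift by `1` after doubling, which changes the sign
of just one of the two series. This turns the sum into an antisymmetric 2×2 determinant. -/
lemma theta1_mul_theta1 (x y : ℂ) {τ : ℂ} (hτ : 0 < τ.im) :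
    theta1 τ (x + y) * theta1 τ (x - y) =
      theta 0 (2 * τ) (2 * x) * theta (-1 / 2) (2 * τ) (2 * y) -
        theta (-1 / 2) (2 * τ) (2 * x) * theta 0 (2 * τ) (2 * y) := by
  have h := theta_mul_theta (x + 1 / 2) y hτ
  rw [show 2 * (x + 1 / 2) = 2 * x + 1 by ring, theta_zero_add_one, theta_neg_half_add_one] at h
  rw [theta1_eq, theta1_eq, neg_mul_neg, show x + y + 1 / 2 = x + 1 / 2 + y by ring,
    show x - y + 1 / 2 = x + 1 / 2 - y by ring, h]
  ring

/-- The three-term identity. -/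
lemma three_term (x y u v : ℂ) {τ : ℂ} (hτ : 0 < τ.im) :
    theta1 τ (x + y) * theta1 τ (x - y) * (theta1 τ (u + v) * theta1 τ (u - v)) =
      theta1 τ (x + u) * theta1 τ (x - u) * (theta1 τ (y + v) * theta1 τ (y - v)) -
        theta1 τ (x + v) * theta1 τ (x - v) * (theta1 τ (y + u) * theta1 τ (y - u)) := by
  -- Every factor is now a 2×2 minor, and what remains is the Plücker relation.
  simp only [theta1_mul_theta1 _ _ hτ]
  ring

lemma theta1_identity {a b c : ℂ} (habc : a + b + c = 0) (z : ℂ) {τ : ℂ} (hτ : 0 < τ.im) :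
    theta1 τ (2 * z) * (theta1 τ a * theta1 τ b * theta1 τ c) =
      theta1 τ z * (theta1 τ (z + a) * theta1 τ (z + b) * theta1 τ (z + c)) -
        theta1 τ z * (theta1 τ (z - a) * theta1 τ (z - b) * theta1 τ (z - c)) := by
  obtain rfl : a = -b - c := by linear_combination habc
  -- With `a = -b - c` these are `x = z + a/2`, `y = z - a/2`, `u = -a/2`, `v = (b - c)/2`, chosen
  -- so that `x + y = 2z`, `x - y = a`, `u + v = b`, `u - v = c`, while `x + u = y - u = z`.
  have h := three_term (z + (-b - c) / 2) (z - (-b - c) / 2) ((b + c) / 2) ((b - c) / 2) hτ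
  ring_nf at h ⊢
  linear_combination h

end JacobiTheta

/-! ### The elliptic genus of a balanced threefold -/

namespace ToricCY3

open JacobiTheta

variable (Y : ToricCY3)

lemma sum_weightForm (v : Y.Vertex) (t₁ t₂ : ℂ) :
    Y.weightForm v 0 t₁ t₂ + Y.weightForm v 1 t₁ t₂ + Y.weightForm v 2 t₁ t₂ = 0 := by
  simp only [weightForm, weight, Fin.isValue, show (0 : Fin 3) + 1 = 1 from rfl,
    show (0 : Fin 3) + 2 = 2 from rfl, show (1 : Fin 3) + 1 = 2 from rfl,
    show (1 : Fin 3) + 2 = 0 from rfl, show (2 : Fin 3) + 1 = 0 from rfl,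
    show (2 : Fin 3) + 2 = 1 from rfl]
  push_cast
  ring

/-- The contribution of a fixed point to the elliptic genus. -/
noncomputable def localGenus (τ z t₁ t₂ : ℂ) (v : Y.Vertex) : ℂ :=
  ∏ j : Fin 3, theta1 τ (z + Y.weightForm v j t₁ t₂) / theta1 τ (Y.weightForm v j t₁ t₂)

variable {Y} {τ t₁ t₂ : ℂ}

/-- Oddness of `theta1` in the three denominators produces the overall sign; the permutation of the
weights only reorders the product. -/
lemma localGenus_balanced {v v' : Y.Vertex} {e : Equiv.Perm (Fin 3)}
    (h : ∀ j, Y.weight v j + Y.weight v' (e j) = 0) (z : ℂ) :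
    Y.localGenus τ z t₁ t₂ v' = -∏ j : Fin 3,
      theta1 τ (z - Y.weightForm v j t₁ t₂) / theta1 τ (Y.weightForm v j t₁ t₂) := by
  have hw : ∀ j, Y.weightForm v' (e j) t₁ t₂ = -Y.weightForm v j t₁ t₂ := by
    intro j
    have h1 := congrArg Prod.fst (h j)
    have h2 := congrArg Prod.snd (h j)
    simp only [Prod.fst_add, Prod.snd_add, Prod.fst_zero, Prod.snd_zero] at h1 h2
    rw [weightForm, weightForm, eq_neg_of_add_eq_zero_right h1, eq_neg_of_add_eq_zero_right h2]
    push_cast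
    ring
  rw [localGenus, ← Equiv.prod_comp e]
  simp only [hw, theta1_neg, ← sub_eq_add_neg, div_neg]
  simp only [Fin.prod_univ_three]
  ring

lemma localGenus_add {v v' : Y.Vertex} {e : Equiv.Perm (Fin 3)}
    (h : ∀ j, Y.weight v j + Y.weight v' (e j) = 0) (z : ℂ) (hτ : 0 < τ.im)
    (hr : Y.IsRegular τ t₁ t₂) :
    theta1 τ z * (Y.localGenus τ z t₁ t₂ v + Y.localGenus τ z t₁ t₂ v') = theta1 τ (2 * z) := by
  have key := theta1_identity (Y.sum_weightForm v t₁ t₂) z hτ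
  have h0 := hr v 0
  have h1 := hr v 1
  have h2 := hr v 2
  rw [localGenus_balanced h, localGenus, Fin.prod_univ_three, Fin.prod_univ_three]
  generalize theta1 τ (2 * z) = T at key ⊢
  field_simp
  linear_combination -key

/-- The map `σ` is a bijection of a finite set, so summing over `v` and over `σ v` gives the genus
twice. The identity is kept free of division by `theta1 τ z`, so that it holds for all `z`. -/
lemma theta1_mul_ellipticGenus (hY : Y.IsBalanced) (z : ℂ) (hτ : 0 < τ.im)
    (hr : Y.IsRegular τ t₁ t₂) :
    theta1 τ z * (2 * Y.ellipticGenus τ z t₁ t₂) = Y.numVertices * theta1 τ (2 * z) := by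
  obtain ⟨σ, hσ, h⟩ := hY
  have hb : Function.Bijective σ := Finite.injective_iff_bijective.1 hσ
  have h2 : 2 * Y.ellipticGenus τ z t₁ t₂ =
      ∑ v, (Y.localGenus τ z t₁ t₂ v + Y.localGenus τ z t₁ t₂ (σ v)) := by
    rw [Finset.sum_add_distrib, hb.sum_comp (Y.localGenus τ z t₁ t₂), two_mul]
    rfl
  rw [h2, Finset.mul_sum, Finset.sum_congr rfl fun v _ => by
    obtain ⟨-, e, he⟩ := h v
    exact localGenus_add he z hτ hr]
  simp

lemma differentiable_ellipticGenus (hτ : 0 < τ.im) :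
    Differentiable ℂ fun z => Y.ellipticGenus τ z t₁ t₂ := by
  have := differentiable_theta1 hτ
  unfold ellipticGenus
  refine Differentiable.fun_sum fun v _ => ?_
  simp only [Fin.prod_univ_three]
  fun_prop

/-- The product of `theta1 τ` with the difference of the two genera vanishes for all `z`. Both
factors are entire in `z`, so one is identically zero; regularity gives a point where `theta1 τ` is
not. -/
lemma ellipticGenus_eq_ellipticGenus (hY : Y.IsBalanced) (hτ : 0 < τ.im) {t₁' t₂' : ℂ}
    (hr : Y.IsRegular τ t₁ t₂) (hr' : Y.IsRegular τ t₁' t₂') (z : ℂ) :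
    Y.ellipticGenus τ z t₁ t₂ = Y.ellipticGenus τ z t₁' t₂' := by
  have h1 : AnalyticOnNhd ℂ (theta1 τ) Set.univ := fun z _ =>
    (differentiable_theta1 hτ).analyticAt z
  have h2 : AnalyticOnNhd ℂ
      (fun z => Y.ellipticGenus τ z t₁ t₂ - Y.ellipticGenus τ z t₁' t₂') Set.univ := fun z _ =>
    ((differentiable_ellipticGenus hτ).sub (differentiable_ellipticGenus hτ)).analyticAt z
  have h3 := h1.eq_zero_or_eq_zero_of_mul_eq_zero h2 (fun w _ => by
    have e1 := theta1_mul_ellipticGenus hY w hτ hr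
    have e2 := theta1_mul_ellipticGenus hY w hτ hr'
    linear_combination (e1 - e2) / 2) isPreconnected_univ
  rcases h3 with h3 | h3
  · exact absurd (h3 _ trivial) (hr ⟨0, Y.numVertices_pos⟩ 0)
  · exact sub_eq_zero.1 (h3 z trivial)

end ToricCY3

theorem mainTheorem3 (Y : ToricCY3) (hY : Y.IsBalanced) :
    Y.HasFiniteHomology ∧
    (∀ τ z t₁ t₂ t₁' t₂' : ℂ, 0 < τ.im → Y.IsRegular τ t₁ t₂ → Y.IsRegular τ t₁' t₂' →
      Y.ellipticGenus τ z t₁ t₂ = Y.ellipticGenus τ z t₁' t₂') ∧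
    (∀ τ z t₁ t₂ : ℂ, 0 < τ.im → Y.IsRegular τ t₁ t₂ → theta1 τ z ≠ 0 →
      Y.ellipticGenus τ z t₁ t₂ =
        (Y.eulerCharacteristic : ℂ) / 2 * (theta1 τ (2 * z) / theta1 τ z)) := by
  refine ⟨Y.hasFiniteHomology, fun τ z t₁ t₂ t₁' t₂' hτ hr hr' =>
    ToricCY3.ellipticGenus_eq_ellipticGenus hY hτ hr hr' z, fun τ z t₁ t₂ hτ hr hz => ?_⟩
  have h := ToricCY3.theta1_mul_ellipticGenus hY z hτ hr
  rw [Y.eulerCharacteristic_eq]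
  push_cast
  field_simp
  linear_combination h
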